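/- Let $\Bbbk$ be a field of characteristic $0$ and let $q\ge 1$ be an integer. Let $f\colon (X,x)\to (X',x')$ be a continuous pointed map between path-connected pointed spaces, each of which is $q$-finite, that is, has the homotopy type of a connected CW-complex with finite $q$-skeleton. Assume that $f$ is $(q-1)$-connected: it induces isomorphisms $\pi_n(X,x)\to\pi_n(X',x')$ for $n\le q-1$ and an epimorphism $\pi_q(X,x)\to\pi_q(X',x')$. Let $G$ be a $\Bbbk$-linear algebraic group (a Zariski closed subgroup of some $\mathrm{GL}_N(\Bbbk)$) and let $\iota\colon G\to \mathrm{GL}(V)$ be a rational representation on a finite-dimensional $\Bbbk$-vector space $V$. For a finitely generated group $\pi$, regard $\mathrm{Hom}(\pi,G)$ as an affine variety, with coordinate ring generated by the matrix entries of the generic matrices $X_g$ ($g\in\pi$), subject to $X_1=1$, $X_{gh}=X_gX_h$ and the equations of $G$. For $i,r\ge 0$ let $$\mathcal V^i_r(X,\iota)=\{\rho\in\mathrm{Hom}(\pi_1(X,x),G)\mid \dim_{\Bbbk}H^i(X,V_{\iota\circ\rho})\ge r\},$$ where $V_{\iota\circ\rho}$ is the local system on $X$ given by the left $\pi_1(X,x)$-module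 $V$ with $g\cdot v=\iota(\rho(g))v$; regular functions on such a subset are the restrictions of regular functions on $\mathrm{Hom}(\pi_1(X,x),G)$. Let $f_\sharp\colon \pi_1(X,x)\to\pi_1(X',x')$ be the induced homomorphism. Then the induced morphism $$f_\sharp^!\colon \mathrm{Hom}(\pi_1(X',x'),G)\to \mathrm{Hom}(\pi_1(X,x),G),\qquad \rho'\mapsto\rho'\circ f_\sharp,$$ is a closed embedding of affine varieties (surjective on coordinate rings, with Zariski closed image, and an isomorphism of varieties onto its image). It restricts to isomorphisms $$\mathcal V^i_r(X',\iota)\;\xrightarrow{\ \cong\ }\;\mathcal V^i_r(X,\iota)\cap f_\sharp^!\bigl(\mathrm{Hom}(\pi_1(X',x'),G)\bigr)\qquad\text{for all } i<q \text{ and } r\ge 0,$$ and to embeddings (injective maps that are isomorphisms onto their images) $\mathcal V^q_r(X',\iota)\to\mathcal V^q_r(X,\iota)$ for all $r\ge 0$. -/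

import Mathlib

open scoped Matrix Topology ContinuousMap

noncomputable section

namespace JumpLoci

/-! ## Homotopy groups, connectivity of maps, finiteness of spaces -/

section Homotopy

variable {X Y : Type*} [TopologicalSpace X] [TopologicalSpace Y]

/-- The map that a continuous map induces on generalized loops. -/
def genLoopMap (N : Type*) (f : C(X, Y)) (x : X) (γ : GenLoop N X x) : GenLoop N Y (f x) :=
  ⟨f.comp γ.1, fun y hy => congrArg f (γ.2 y hy)⟩

/-- The map `π_n(X, x) → π_n(Y, f x)` induced by a continuous map `f`. -/
def homotopyGroupMap (n : ℕ) (f : C(X, Y)) (x : X) :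
    HomotopyGroup.Pi n X x → HomotopyGroup.Pi n Y (f x) :=
  Quotient.map (genLoopMap (Fin n) f x) fun _ _ h => h.map fun H => H.compContinuousMap f

/-- A pointed map `f : (X, x) → (Y, f x)` of path-connected spaces is `q`-connected if it induces
isomorphisms on homotopy groups up to degree `q` and an epimorphism in degree `q + 1`. -/
def IsQConnectedMap (q : ℕ) (f : C(X, Y)) (x : X) : Prop :=
  (∀ n ≤ q, Function.Bijective (homotopyGroupMap n f x)) ∧
    Function.Surjective (homotopyGroupMap (q + 1) f x)

/-- A space is `q`-finite if it has the homotopy type of a connected CW-complex with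
finite `q`-skeleton. -/
def IsQFinite.{u} (q : ℕ) (X : Type u) [TopologicalSpace X] : Prop :=
  ∃ (Y : Type u) (_ : TopologicalSpace Y) (_ : T2Space Y) (_ : ConnectedSpace Y)
    (_ : Topology.CWComplex (Set.univ : Set Y)),
    (∀ n ≤ q, Finite (Topology.CWComplex.cell (Set.univ : Set Y) n)) ∧ Nonempty (X ≃ₕ Y)

end Homotopy

/-! ## Singular cohomology with coefficients in a local system -/

section Twisted

/-- The standard topological `n`-simplex. -/
abbrev Simplex (n : ℕ) : Type := stdSimplex ℝ (Fin (n + 1))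

/-- The initial vertex of the standard simplex. -/
abbrev v₀ (n : ℕ) : Simplex n := stdSimplex.vertex 0

/-- The inclusion of the `i`-th face of the standard simplex. -/
def face {n : ℕ} (i : Fin (n + 2)) : C(Simplex n, Simplex (n + 1)) :=
  ⟨stdSimplex.map i.succAbove, stdSimplex.continuous_map _⟩

/-- The homotopy class of paths between two points of a standard simplex; there is only one. -/
def simplexPath {n : ℕ} (a b : Simplex n) : Path.Homotopic.Quotient a b :=
  .mk (PathConnectedSpace.somePath a b)

instance (n : ℕ) : SimplyConnectedSpace (Simplex n) :=
  haveI : ContractibleSpace (Simplex n) :=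
    (convex_stdSimplex ℝ (Fin (n + 1))).contractibleSpace ⟨_, (v₀ n).2⟩
  inferInstance

theorem simplexPath_unique {n : ℕ} {a b : Simplex n} (p q : Path.Homotopic.Quotient a b) :
    p = q := Subsingleton.elim _ _

variable {k : Type*} [Field k] {V : Type*} [AddCommGroup V] [Module k V]
variable {X : Type*} [TopologicalSpace X]

/-- Singular `n`-cochains of `X` with coefficients in the local system `V_τ` defined by the left
`π₁(X, x)`-module `V` with `g • v = τ g v`.

A pair consisting of a singular simplex `σ` of `X` and a homotopy class `p` of paths from `x` to
the initial vertex of `σ` is the same as a singular simplex of the universal cover, so these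
cochains are the equivariant functions on the singular simplices of the universal cover.
Mathlib's product `g * h` in the fundamental group is the concatenation "first `h`, then `g`", so
that the left action of `g` on `p` is the concatenation of `g⁻¹` and `p`. -/
def equivariantCochains (x : X) (τ : FundamentalGroup X x →* LinearMap.GeneralLinearGroup k V)
    (n : ℕ) : Submodule k ((σ : C(Simplex n, X)) → Path.Homotopic.Quotient x (σ (v₀ n)) → V) where
  carrier := {c | ∀ (σ : C(Simplex n, X)) (p : Path.Homotopic.Quotient x (σ (v₀ n)))
    (g : FundamentalGroup X x), c σ ((FundamentalGroup.toPath g⁻¹).trans p) = (τ g).1 (c σ p)}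
  zero_mem' := fun σ p g => by simp
  add_mem' := fun {a b} ha hb σ p g => by simp [ha σ p g, hb σ p g]
  smul_mem' := fun r a ha σ p g => by simp [ha σ p g]

/-- The space `C^n(X, V_τ)` of singular `n`-cochains with coefficients in `V_τ`. -/
def TwistedCochains (x : X) (τ : FundamentalGroup X x →* LinearMap.GeneralLinearGroup k V)
    (n : ℕ) : Type _ := equivariantCochains x τ n

instance (x : X) (τ : FundamentalGroup X x →* LinearMap.GeneralLinearGroup k V) (n : ℕ) :
    AddCommGroup (TwistedCochains x τ n) :=
  inferInstanceAs (AddCommGroup (equivariantCochains x τ n))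

instance (x : X) (τ : FundamentalGroup X x →* LinearMap.GeneralLinearGroup k V) (n : ℕ) :
    Module k (TwistedCochains x τ n) :=
  inferInstanceAs (Module k (equivariantCochains x τ n))

/-- The `i`-th coface map. The path to the initial vertex of a simplex is prolonged, inside the
simplex, to the initial vertex of its `i`-th face. -/
def coface (x : X) (τ : FundamentalGroup X x →* LinearMap.GeneralLinearGroup k V)
    {n : ℕ} (i : Fin (n + 2)) : TwistedCochains x τ n →ₗ[k] TwistedCochains x τ (n + 1) where
  toFun c := ⟨fun σ p => c.1 (σ.comp (face i))
    (p.trans ((simplexPath (v₀ (n + 1)) (face i (v₀ n))).map σ)), fun σ p g => by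
      rw [← c.2]
      exact congrArg (c.1 (σ.comp (face i))) (Path.Homotopic.Quotient.trans_assoc _ _ _)⟩
  map_add' _ _ := rfl
  map_smul' _ _ := rfl

/-- The differential of twisted singular cochains. -/
def twistedDifferential (x : X) (τ : FundamentalGroup X x →* LinearMap.GeneralLinearGroup k V)
    (n : ℕ) : TwistedCochains x τ n →ₗ[k] TwistedCochains x τ (n + 1) :=
  ∑ i : Fin (n + 2), (-1 : k) ^ (i : ℕ) • coface x τ i

theorem face_comp_face {n : ℕ} {i j : Fin (n + 2)} (h : i ≤ j) :
    (face j.succ).comp (face i) = (face i.castSucc).comp (face j) := by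
  ext1 a
  simp only [face, ContinuousMap.comp_apply, ContinuousMap.coe_mk, stdSimplex.map_comp_apply]
  congr 1
  exact congrArg (fun g => ⇑(SimplexCategory.Hom.toOrderHom g)) (SimplexCategory.δ_comp_δ h)

theorem coface_comp_coface (x : X) (τ : FundamentalGroup X x →* LinearMap.GeneralLinearGroup k V)
    {n : ℕ} {i j : Fin (n + 2)} (h : i ≤ j) :
    coface x τ j.succ ∘ₗ coface x τ i = coface x τ i.castSucc ∘ₗ coface x τ j := by
  have key : ∀ (c : TwistedCochains x τ n) (σ : C(Simplex (n + 2), X))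
      (p : Path.Homotopic.Quotient x (σ (v₀ (n + 2)))) (a b : C(Simplex n, Simplex (n + 2)))
      (_ : a = b) (u : Path.Homotopic.Quotient (v₀ (n + 2)) (a (v₀ n)))
      (w : Path.Homotopic.Quotient (v₀ (n + 2)) (b (v₀ n))),
      c.1 (σ.comp a) (p.trans (u.map σ)) = c.1 (σ.comp b) (p.trans (w.map σ)) := by
    rintro c σ p a _ rfl u w
    rw [simplexPath_unique u w]
  have step : ∀ (c : TwistedCochains x τ n) (i : Fin (n + 2)) (j : Fin (n + 3))
      (σ : C(Simplex (n + 2), X)) (p : Path.Homotopic.Quotient x (σ (v₀ (n + 2)))),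
      (coface x τ j (coface x τ i c)).1 σ p = c.1 (σ.comp ((face j).comp (face i)))
        (p.trans (((simplexPath (v₀ (n + 2)) (face j (v₀ (n + 1)))).trans
          ((simplexPath (v₀ (n + 1)) (face i (v₀ n))).map (face j))).map σ)) := by
    intro c i j σ p
    have e : ∀ {a b d : Simplex (n + 2)} (u : Path.Homotopic.Quotient a b)
        (w : Path.Homotopic.Quotient b d), (u.trans w).map σ = (u.map σ).trans (w.map σ) := by
      rintro a b d ⟨u⟩ ⟨w⟩
      exact congrArg Path.Homotopic.Quotient.mk (Path.map_trans u w σ.continuous)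
    rw [e, ← Path.Homotopic.Quotient.trans_assoc, ← Path.Homotopic.Quotient.map_comp]
    rfl
  refine LinearMap.ext fun c => Subtype.ext (funext fun σ => funext fun p => ?_)
  simp only [LinearMap.comp_apply, step]
  exact key c σ p _ _ (face_comp_face h) _ _

theorem twistedDifferential_comp (x : X)
    (τ : FundamentalGroup X x →* LinearMap.GeneralLinearGroup k V) (n : ℕ) :
    twistedDifferential x τ (n + 1) ∘ₗ twistedDifferential x τ n = 0 := by
  refine LinearMap.ext fun c => ?_
  simp only [twistedDifferential, LinearMap.comp_apply, LinearMap.sum_apply, LinearMap.smul_apply,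
    map_sum, map_smul, LinearMap.zero_apply, Finset.smul_sum]
  rw [← Finset.sum_product', Finset.univ_product_univ]
  rw [← Finset.sum_filter_add_sum_filter_not _
    (fun ij : Fin (n + 2) × Fin (n + 3) => (ij.2 : ℕ) ≤ (ij.1 : ℕ)), ← eq_neg_iff_add_eq_zero,
    ← Finset.sum_neg_distrib]
  refine Finset.sum_bij' (fun ij h => ((ij.2.castLT (by
      simp only [Finset.mem_filter] at h; omega), ij.1.succ) : Fin (n + 2) × Fin (n + 3)))
    (fun ij h => ((ij.2.pred (by
      rintro h0; simp [h0] at h), ij.1.castSucc) : Fin (n + 2) × Fin (n + 3)))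
    ?_ ?_ ?_ ?_ ?_
  · rintro ⟨i, j⟩ h
    simp only [Finset.mem_filter, Finset.mem_univ, true_and, Fin.val_succ, Fin.val_castLT] at h ⊢
    omega
  · rintro ⟨i, j⟩ h
    simp only [Finset.mem_filter, Finset.mem_univ, true_and, Fin.val_pred,
      Fin.val_castSucc] at h ⊢
    omega
  · rintro ⟨i, j⟩ h
    simp
  · rintro ⟨i, j⟩ h
    simp
  · rintro ⟨i, j⟩ h
    simp only [Finset.mem_filter, Finset.mem_univ, true_and] at h
    have hj : (j.castLT (by omega) : Fin (n + 2)) ≤ i := h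
    have := LinearMap.congr_fun (coface_comp_coface x τ hj) c
    simp only [Fin.castSucc_castLT, LinearMap.comp_apply] at this
    simp only [smul_smul, this, Fin.val_succ, Fin.val_castLT, ← neg_smul]
    congr 1
    ring

/-- The space of twisted coboundaries of degree `n`. -/
def twistedCoboundaries (x : X) (τ : FundamentalGroup X x →* LinearMap.GeneralLinearGroup k V) :
    (n : ℕ) → Submodule k (TwistedCochains x τ n)
  | 0 => ⊥
  | n + 1 => LinearMap.range (twistedDifferential x τ n)

/-- The twisted cohomology `H^n(X, V_τ)`. -/
abbrev TwistedCohomology (x : X) (τ : FundamentalGroup X x →* LinearMap.GeneralLinearGroup k V)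
    (n : ℕ) : Type _ :=
  LinearMap.ker (twistedDifferential x τ n) ⧸
    (twistedCoboundaries x τ n).submoduleOf (LinearMap.ker (twistedDifferential x τ n))

end Twisted

/-! ## Linear algebraic groups and representation varieties -/

section RepVar

variable {k : Type*} [Field k] {N : ℕ}

/-- The point of affine `N²`-space given by the entries of a matrix. -/
def entries (g : GL (Fin N) k) : Fin N × Fin N → k := fun ij => g.1 ij.1 ij.2

/-- The ideal of the polynomials in the matrix entries that vanish on `G`. -/
def groupIdeal (G : Subgroup (GL (Fin N) k)) : Ideal (MvPolynomial (Fin N × Fin N) k) :=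
  MvPolynomial.vanishingIdeal k (entries '' (G : Set (GL (Fin N) k)))

/-- A `k`-linear algebraic group is a Zariski closed subgroup of some `GL_N(k)`. -/
def IsLinearAlgebraicGroup (G : Subgroup (GL (Fin N) k)) : Prop :=
  ∀ g : GL (Fin N) k, entries g ∈ MvPolynomial.zeroLocus k (groupIdeal G) → g ∈ G

/-- A representation of a linear algebraic group is rational if its matrix coefficients are regular
functions, that is, polynomials in the matrix entries and the inverse of the determinant. -/
def IsRationalRepresentation {V : Type*} [AddCommGroup V] [Module k V]
    {G : Subgroup (GL (Fin N) k)} (ι : G →* LinearMap.GeneralLinearGroup k V) : Prop :=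
  ∀ (φ : Module.Dual k V) (v : V), ∃ (p : MvPolynomial (Fin N × Fin N) k) (m : ℕ),
    ∀ g : G, φ ((ι g).1 v) = MvPolynomial.eval (entries g.1) p * (g.1.1.det)⁻¹ ^ m

variable (k) in
/-- The generic matrix `X_g` attached to an element `g` of the group `π`. -/
def genericMatrix (N : ℕ) {π : Type*} (g : π) :
    Matrix (Fin N) (Fin N) (MvPolynomial (π × Fin N × Fin N) k) :=
  Matrix.of fun i j => MvPolynomial.X (g, i, j)

/-- The equations of the representation variety: `X_1 = 1`, `X_{gh} = X_g X_h`, and every `X_g`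
satisfies the equations of `G`. -/
def repRelations (π : Type*) [Group π] (G : Subgroup (GL (Fin N) k)) :
    Set (MvPolynomial (π × Fin N × Fin N) k) :=
  {a | ∃ i j, a = (genericMatrix k N (1 : π) - 1) i j} ∪
  {a | ∃ (g h : π) (i j : Fin N),
    a = (genericMatrix k N (g * h) - genericMatrix k N g * genericMatrix k N h) i j} ∪
  {a | ∃ (g : π), ∃ p ∈ groupIdeal G,
    a = MvPolynomial.aeval (fun ij : Fin N × Fin N => genericMatrix k N g ij.1 ij.2) p}

/-- The coordinate ring of the representation variety `Hom(π, G)`; it represents the functor that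
takes a commutative `k`-algebra `R` to `Hom(π, G(R))`. When `π` is finitely generated, it is a
finitely generated `k`-algebra. -/
abbrev RepRing (π : Type*) [Group π] (G : Subgroup (GL (Fin N) k)) : Type _ :=
  MvPolynomial (π × Fin N × Fin N) k ⧸ Ideal.span (repRelations π G)

/-- Evaluation of the elements of the coordinate ring at a point `ρ` of `Hom(π, G)`. -/
def evalRep {π : Type*} [Group π] {G : Subgroup (GL (Fin N) k)} (ρ : π →* G) :
    RepRing π G →ₐ[k] k :=
  Ideal.Quotient.liftₐ _ (MvPolynomial.aeval fun gij => (ρ gij.1).1.1 gij.2.1 gij.2.2) <| by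
    have hX : ∀ (g : π) (i j : Fin N), MvPolynomial.aeval (R := k)
        (fun gij : π × Fin N × Fin N => (ρ gij.1).1.1 gij.2.1 gij.2.2)
        (genericMatrix k N g i j) = (ρ g).1.1 i j := fun g i j => by simp [genericMatrix]
    suffices h : Ideal.span (repRelations π G) ≤ RingHom.ker (MvPolynomial.aeval (R := k)
        (fun gij : π × Fin N × Fin N => (ρ gij.1).1.1 gij.2.1 gij.2.2)) from fun a ha => h ha
    rw [Ideal.span_le]
    rintro a ((⟨i, j, rfl⟩ | ⟨g, h, i, j, rfl⟩) | ⟨g, p, hp, rfl⟩)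
    · rw [SetLike.mem_coe, RingHom.mem_ker, Matrix.sub_apply, map_sub, hX, map_one]
      by_cases hij : i = j <;> simp [Matrix.one_apply, hij]
    · rw [SetLike.mem_coe, RingHom.mem_ker, Matrix.sub_apply, map_sub, hX, map_mul,
        Matrix.mul_apply, map_sum]
      simp only [map_mul, hX]
      simp [Matrix.mul_apply]
    · rw [SetLike.mem_coe, RingHom.mem_ker, ← AlgHom.comp_apply, MvPolynomial.comp_aeval]
      simp only [hX]
      exact hp _ ⟨_, (ρ g).2, rfl⟩

/-- The morphism `φ^! : Hom(π', G) → Hom(π, G)` induced by `φ : π → π'`, on points. -/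
def repPullback {π π' : Type*} [Group π] [Group π'] (φ : π →* π') (G : Subgroup (GL (Fin N) k))
    (ρ : π' →* G) : π →* G := ρ.comp φ

/-- The morphism `φ^!` on coordinate rings, `X_g ↦ X_{φ(g)}`. -/
def repComorphism {π π' : Type*} [Group π] [Group π'] (φ : π →* π')
    (G : Subgroup (GL (Fin N) k)) : RepRing π G →ₐ[k] RepRing π' G :=
  Ideal.quotientMapₐ _ (MvPolynomial.rename (Prod.map φ id)) <| by
    have hX : ∀ (g : π) (i j : Fin N), MvPolynomial.rename (R := k) (Prod.map φ id)
        (genericMatrix k N g i j) = genericMatrix k N (φ g) i j :=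
      fun g i j => by simp [genericMatrix]
    rw [Ideal.span_le]
    rintro a ((⟨i, j, rfl⟩ | ⟨g, h, i, j, rfl⟩) | ⟨g, p, hp, rfl⟩) <;>
      refine Ideal.subset_span ?_
    · refine Or.inl (Or.inl ⟨i, j, ?_⟩)
      change MvPolynomial.rename (R := k) (Prod.map φ id) _ = _
      rw [Matrix.sub_apply, map_sub, hX, map_one, Matrix.sub_apply]
      by_cases hij : i = j <;> simp [Matrix.one_apply, hij]
    · refine Or.inl (Or.inr ⟨φ g, φ h, i, j, ?_⟩)
      simp [hX, Matrix.mul_apply]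
    · refine Or.inr ⟨φ g, p, hp, ?_⟩
      change MvPolynomial.rename (R := k) (Prod.map φ id) _ = _
      rw [← AlgHom.comp_apply, MvPolynomial.comp_aeval]
      simp only [hX]

theorem evalRep_repComorphism {π π' : Type*} [Group π] [Group π'] (φ : π →* π')
    (G : Subgroup (GL (Fin N) k)) (ρ : π' →* G) (a : RepRing π G) :
    evalRep ρ (repComorphism φ G a) = evalRep (repPullback φ G ρ) a := by
  obtain ⟨a, rfl⟩ := Ideal.Quotient.mk_surjective a
  change MvPolynomial.aeval _ (MvPolynomial.rename _ a) = MvPolynomial.aeval _ a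
  rw [MvPolynomial.aeval_rename]
  rfl

section Subsets

variable {π π' : Type*} [Group π] [Group π'] {G : Subgroup (GL (Fin N) k)}

/-- The regular functions on a subset `Z` of `Hom(π, G)`: the restrictions of the elements of the
coordinate ring. For a closed subvariety `Z`, this is its coordinate ring. -/
def regularFunctions (Z : Set (π →* G)) : Set (Z → k) :=
  Set.range fun (a : RepRing π G) (ρ : Z) => evalRep ρ.1 a

/-- Zariski closed subsets of `Hom(π, G)`. -/
def IsZariskiClosed (Z : Set (π →* G)) : Prop :=
  ∃ S : Set (RepRing π G), Z = {ρ | ∀ a ∈ S, evalRep ρ a = 0}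

/-- An embedding: an injective map that is an isomorphism onto its image, that is, a
function on the source is regular iff it is the pull-back of a regular function on the target. -/
def IsVarietyEmbedding {Z' : Set (π' →* G)} {Z : Set (π →* G)} (F : Z' → Z) : Prop :=
  Function.Injective F ∧
    ∀ h' : Z' → k, h' ∈ regularFunctions Z' ↔ ∃ h ∈ regularFunctions Z, h' = h ∘ F

/-- An isomorphism of varieties: a bijective map such that a function on the target is regular
iff its pull-back to the source is regular. -/
def IsVarietyIso {Z' : Set (π' →* G)} {Z : Set (π →* G)} (F : Z' → Z) : Prop :=
  Function.Bijective F ∧ ∀ h : Z → k, h ∈ regularFunctions Z ↔ h ∘ F ∈ regularFunctions Z'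

/-- The morphism `φ^! : Hom(π', G) → Hom(π, G)` is a closed embedding: it is a closed immersion of
affine schemes (surjective on coordinate rings), its image on points is Zariski closed, and it is
an isomorphism of varieties onto this image. -/
def IsClosedEmbeddingOfRepVarieties (φ : π →* π') (G : Subgroup (GL (Fin N) k)) : Prop :=
  Function.Surjective (repComorphism φ G) ∧
    IsZariskiClosed (Set.range (repPullback φ G)) ∧
    ∃ h : Set.MapsTo (repPullback φ G) Set.univ (Set.range (repPullback φ G)),
      IsVarietyIso h.restrict

/-- The characteristic variety `V^i_r(X, ι)`. -/
def jumpLocus {X : Type*} [TopologicalSpace X] (x : X) {V : Type*} [AddCommGroup V] [Module k V]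
    (ι : G →* LinearMap.GeneralLinearGroup k V) (i r : ℕ) : Set (FundamentalGroup X x →* G) :=
  {ρ | (r : Cardinal) ≤ Module.rank k (TwistedCohomology x (ι.comp ρ) i)}

end Subsets

end RepVar

end JumpLoci

end

/-!
The representation varieties are compared through the surjectivity of `f_♯` on fundamental groups
alone, and the jump loci through the maps `H^n(X', V_τ) → H^n(X, V_τ)` induced by `f`: they are
injective for `n ≤ q` (`IsQConnectedMap.cohomologyMap_injective`) and surjective for `n < q`
(`IsQConnectedMap.cohomologyMap_surjective`), so that the dimension in degree `n` can only grow
along `f^!`, and is preserved for `n < q`. On the algebraic side, for a surjection `φ : π → π'`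
every generator `X_g` of the coordinate ring of `Hom(π', G)` is in the image of the comorphism
of `φ^!`. The image of `φ^!` is cut out by `X_g = 1` for `g ∈ ker φ`, and on every subset of
`Hom(π', G)` the regular functions are the pull-backs of regular functions
(`isVarietyEmbedding_restrict_repPullback`).

The cohomological statement is proved on singular cochains, without CW approximation. The map `f`
factors as `const : X → PathSpace f`, which induces the inverse of the isomorphism given by
`source`, followed by `endpoint : PathSpace f → X'`. Compression of cubes along `f`
(`compressible_cube`), which is what bijectivity and surjectivity on homotopy groups provide, says
that `endpoint` has the right lifting property with respect to the inclusions `∂Iⁿ → Iⁿ` for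
`n ≤ q` (`IsQConnectedMap.hasLift_endpoint`). The same is true of `source`, in all degrees
(`PathSpace.hasLift_source`).

Let `p : E → B` be any map with this lifting property for `n ≤ q`. It passes from cubes to
simplices and to prisms over simplices, so that singular simplices of dimension at most `q` have
lifts compatible with faces (`exists_section`), and two simplices of dimension less than `q` with
the same image are homotopic over `B`, again compatibly with faces
(`exists_fibrewise_homotopies`). Evaluation of a cochain on the chosen lifts is a cochain map, left
inverse to the pull-back along `p`, whence injectivity
(`mem_coboundaries_of_cochainPullback`). The prism operator of the fibrewise homotopies shows that
it is also a right inverse on cohomology, whence surjectivity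
(`exists_cochainPullback_sub_mem_coboundaries`).

A twisted cochain is evaluated at a simplex with a path from the base point to its initial vertex.
Since `p` lifts paths, these paths may be replaced by their images in `B`; the prism operator is
therefore written for simplices with an arbitrary labelling of their points, to be specialized to
labels in the universal cover of `B`.
-/

noncomputable section

namespace JumpLoci

/-! ### Representation varieties and surjections of groups -/

section RepresentationVarieties

variable {k : Type*} [Field k] {N : ℕ} {π π' : Type*} [Group π] [Group π']
  {G : Subgroup (GL (Fin N) k)} {φ : π →* π'}

theorem repComorphism_surjective (hφ : Function.Surjective φ) :
    Function.Surjective (repComorphism φ G) := by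
  intro b
  obtain ⟨b, rfl⟩ := Ideal.Quotient.mk_surjective b
  have hr : Function.Surjective
      (MvPolynomial.rename (R := k) (Prod.map φ (id : Fin N × Fin N → Fin N × Fin N))) :=
    MvPolynomial.rename_surjective _ (hφ.prodMap Function.surjective_id)
  obtain ⟨a, rfl⟩ := hr b
  exact ⟨Ideal.Quotient.mk _ a, rfl⟩

theorem repPullback_injective (hφ : Function.Surjective φ) :
    Function.Injective (repPullback φ G) := fun ρ₁ ρ₂ h =>
  MonoidHom.ext fun g => by
    obtain ⟨g, rfl⟩ := hφ g
    exact DFunLike.congr_fun h g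

/-- The matrix entry `(X_g)_{ij}` as an element of the coordinate ring. -/
def coordinate (G : Subgroup (GL (Fin N) k)) (g : π) (i j : Fin N) : RepRing π G :=
  Ideal.Quotient.mk _ (MvPolynomial.X (g, i, j))

@[simp]
theorem evalRep_coordinate (ρ : π →* G) (g : π) (i j : Fin N) :
    evalRep ρ (coordinate G g i j) = (ρ g).1.1 i j :=
  MvPolynomial.aeval_X _ _

/-- The image of `φ^!` is cut out by the equations `X_g = 1` for `g` in the kernel of `φ`. -/
theorem isZariskiClosed_range_repPullback (hφ : Function.Surjective φ) :
    IsZariskiClosed (Set.range (repPullback φ G)) := by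
  refine ⟨{a | ∃ g ∈ φ.ker, ∃ i j, a = coordinate G g i j - coordinate G 1 i j}, ?_⟩
  ext ρ
  constructor
  · rintro ⟨ρ', rfl⟩ _ ⟨g, hg, i, j, rfl⟩
    rw [map_sub, evalRep_coordinate, evalRep_coordinate, sub_eq_zero]
    change (ρ' (φ g)).1.1 i j = (ρ' (φ 1)).1.1 i j
    rw [MonoidHom.mem_ker.1 hg, map_one φ]
  · intro h
    have hker : φ.ker ≤ ρ.ker := fun g hg => by
      rw [MonoidHom.mem_ker, ← map_one ρ]
      refine Subtype.ext (Units.ext (Matrix.ext fun i j => sub_eq_zero.1 ?_))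
      simpa using h _ ⟨g, hg, i, j, rfl⟩
    refine ⟨φ.liftOfSurjective hφ ⟨ρ, hker⟩, ?_⟩
    exact φ.liftOfRightInverse_comp _ _ ⟨ρ, hker⟩

/-- For surjective `φ`, the regular functions on `Z'` are the pull-backs along `φ^!` of the regular
functions on any subset `Z` containing the image of `Z'`. -/
theorem isVarietyEmbedding_restrict_repPullback (hφ : Function.Surjective φ)
    {Z' : Set (π' →* G)} {Z : Set (π →* G)} (h : Set.MapsTo (repPullback φ G) Z' Z) :
    IsVarietyEmbedding h.restrict := by
  refine ⟨h.restrict_inj.2 (repPullback_injective hφ).injOn, fun h' => ⟨?_, ?_⟩⟩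
  · rintro ⟨a', rfl⟩
    obtain ⟨a, rfl⟩ := repComorphism_surjective hφ a'
    exact ⟨_, ⟨a, rfl⟩, funext fun ρ => evalRep_repComorphism φ G ρ.1 a⟩
  · rintro ⟨_, ⟨a, rfl⟩, rfl⟩
    exact ⟨repComorphism φ G a, funext fun ρ => evalRep_repComorphism φ G ρ.1 a⟩

theorem isVarietyIso_restrict_repPullback (hφ : Function.Surjective φ)
    {Z' : Set (π' →* G)} {Z : Set (π →* G)} (h : Set.MapsTo (repPullback φ G) Z' Z)
    (hs : Set.SurjOn (repPullback φ G) Z' Z) :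
    IsVarietyIso h.restrict := by
  have he := isVarietyEmbedding_restrict_repPullback hφ h
  have hsurj : Function.Surjective h.restrict := h.restrict_surjective_iff.2 hs
  refine ⟨⟨he.1, hsurj⟩, fun u => ?_⟩
  rw [he.2]
  refine ⟨fun hu => ⟨u, hu, rfl⟩, ?_⟩
  rintro ⟨w, hw, hwu⟩
  rwa [hsurj.injective_comp_right hwu]

theorem isClosedEmbeddingOfRepVarieties (hφ : Function.Surjective φ) :
    IsClosedEmbeddingOfRepVarieties φ G :=
  ⟨repComorphism_surjective hφ, isZariskiClosed_range_repPullback hφ,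
    fun ρ _ => Set.mem_range_self ρ, isVarietyIso_restrict_repPullback hφ _ <| by
      rintro _ ⟨ρ, rfl⟩
      exact ⟨ρ, trivial, rfl⟩⟩

end RepresentationVarieties

section UnitInterval

open scoped unitInterval

/-! ### Homotopy extension for cubes and prisms -/

section HomotopyExtension

variable {D D' Y : Type*} [TopologicalSpace D] [TopologicalSpace D'] [TopologicalSpace Y]

/-- The homotopy extension property of a pair `(D, A)`, expressed by a retraction of the cylinder
`D × I` onto `D × {0} ∪ A × I`. -/
def HasHEP (A : Set D) : Prop :=
  ∃ ρ : C(D × I, D × I), (∀ z, (ρ z).2 = 0 ∨ (ρ z).1 ∈ A) ∧ ∀ z, z.2 = 0 ∨ z.1 ∈ A → ρ z = z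

/-- The boundary `A × I ∪ D × {0, 1}` of the prism over a pair `(D, A)`. -/
def prismBoundary (A : Set D) : Set (D × I) := {z | z.1 ∈ A ∨ z.2 = 0 ∨ z.2 = 1}

theorem isClosed_prismBoundary {A : Set D} (hA : IsClosed A) : IsClosed (prismBoundary A) :=
  (hA.preimage continuous_fst).union
    ((isClosed_eq continuous_snd continuous_const).union
      (isClosed_eq continuous_snd continuous_const))

theorem HasHEP.of_homeomorph {A : Set D} {A' : Set D'} (h : HasHEP A) (e : D ≃ₜ D')
    (he : ∀ d, e d ∈ A' ↔ d ∈ A) : HasHEP A' := by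
  obtain ⟨ρ, h1, h2⟩ := h
  refine ⟨⟨fun z => (e (ρ (e.symm z.1, z.2)).1, (ρ (e.symm z.1, z.2)).2), by fun_prop⟩,
    fun z => ?_, fun z hz => ?_⟩
  · simpa [he] using h1 (e.symm z.1, z.2)
  · have : ρ (e.symm z.1, z.2) = (e.symm z.1, z.2) := h2 _ (by simpa [← he] using hz)
    simp [this]

/-- Homotopies prescribed on a closed subset `A` with the homotopy extension property extend. -/
theorem HasHEP.exists_extension {A : Set D} (h : HasHEP A) (hA : IsClosed A) (v : C(D, Y))
    (g : D × I → Y) (hg : ContinuousOn g {z | z.1 ∈ A}) (hgv : ∀ d ∈ A, g (d, 0) = v d) :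
    ∃ H : C(D × I, Y), (∀ d, H (d, 0) = v d) ∧ ∀ d ∈ A, ∀ t, H (d, t) = g (d, t) := by
  classical
  obtain ⟨ρ, h1, h2⟩ := h
  let G : D × I → Y := fun z => if z.1 ∈ A then g z else v z.1
  have hG0 : ∀ z : D × I, z.2 = 0 → G z = v z.1 := by
    rintro ⟨d, t⟩ (rfl : t = 0)
    by_cases hd : d ∈ A
    · simp [G, hd, hgv]
    · simp [G, hd]
  have hG : ContinuousOn G ({z | z.2 = 0} ∪ {z | z.1 ∈ A}) := by
    refine ContinuousOn.union_of_isClosed ?_ ?_ (isClosed_eq continuous_snd continuous_const)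
      (hA.preimage continuous_fst)
    · exact ContinuousOn.congr (f := fun z : D × I => v z.1)
        (by fun_prop) fun z hz => hG0 z hz
    · exact hg.congr fun z hz => if_pos hz
  refine ⟨⟨fun z => G (ρ z), hG.comp_continuous ρ.continuous fun z => h1 z⟩, fun d => ?_,
    fun d hd t => ?_⟩
  · change G (ρ (d, 0)) = _
    rw [h2 _ (Or.inl rfl), hG0 _ rfl]
  · change G (ρ (d, t)) = _
    rw [h2 _ (Or.inr hd)]
    exact if_pos hd

/-- A homotopy `H₀` on `D × I` is moved to another one along prescribed motions `b`, `c` of its two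
ends and `k` of its restriction to `A`. -/
theorem HasHEP.exists_moved_homotopy {A : Set D} (h : HasHEP (prismBoundary A)) (hA : IsClosed A)
    (H₀ b c : C(D × I, Y)) (k : D × I × I → Y) (hk : ContinuousOn k {z | z.1 ∈ A})
    (hkb : ∀ d ∈ A, ∀ s, k (d, 0, s) = b (d, s)) (hkc : ∀ d ∈ A, ∀ s, k (d, 1, s) = c (d, s))
    (hb : ∀ d, H₀ (d, 0) = b (d, 0)) (hc : ∀ d, H₀ (d, 1) = c (d, 0))
    (hk₀ : ∀ d ∈ A, ∀ t, H₀ (d, t) = k (d, t, 0)) :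
    ∃ H₁ : C(D × I, Y), (∀ d, H₁ (d, 0) = b (d, 1)) ∧ (∀ d, H₁ (d, 1) = c (d, 1)) ∧
      ∀ d ∈ A, ∀ t, H₁ (d, t) = k (d, t, 1) := by
  classical
  let g : (D × I) × I → Y := fun z =>
    if z.1.1 ∈ A then k (z.1.1, z.1.2, z.2) else if z.1.2 = 0 then b (z.1.1, z.2)
    else c (z.1.1, z.2)
  have gA : ∀ d ∈ A, ∀ t s, g ((d, t), s) = k (d, t, s) := fun d hd t s => if_pos hd
  have gb : ∀ d s, g ((d, 0), s) = b (d, s) := fun d s => by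
    by_cases hd : d ∈ A
    · rw [gA d hd, hkb d hd]
    · simp [g, hd]
  have gc : ∀ d s, g ((d, 1), s) = c (d, s) := fun d s => by
    by_cases hd : d ∈ A
    · rw [gA d hd, hkc d hd]
    · simp [g, hd]
  have hg : ContinuousOn g
      ({z | z.1.1 ∈ A} ∪ ({z | z.1.2 = 0} ∪ {z | z.1.2 = 1})) := by
    have cl0 : IsClosed {z : (D × I) × I | z.1.2 = 0} :=
      isClosed_eq (by fun_prop) continuous_const
    have cl1 : IsClosed {z : (D × I) × I | z.1.2 = 1} :=
      isClosed_eq (by fun_prop) continuous_const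
    refine ContinuousOn.union_of_isClosed ?_ (ContinuousOn.union_of_isClosed ?_ ?_ cl0 cl1)
      (hA.preimage (by fun_prop)) (cl0.union cl1)
    · refine ContinuousOn.congr (f := fun z : (D × I) × I => k (z.1.1, z.1.2, z.2)) ?_
        fun z hz => gA _ hz _ _
      exact hk.comp (by fun_prop) fun z hz => hz
    · refine ContinuousOn.congr (f := fun z : (D × I) × I => b (z.1.1, z.2)) (by fun_prop) ?_
      rintro ⟨⟨d, t⟩, s⟩ (rfl : t = 0)
      exact gb d s
    · refine ContinuousOn.congr (f := fun z : (D × I) × I => c (z.1.1, z.2)) (by fun_prop) ?_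
      rintro ⟨⟨d, t⟩, s⟩ (rfl : t = 1)
      exact gc d s
  obtain ⟨H, hH0, hH⟩ := h.exists_extension (isClosed_prismBoundary hA) H₀ g hg (by
    rintro ⟨d, t⟩ (hd | rfl | rfl)
    · rw [gA d hd, hk₀ d hd]
    · rw [gb, hb]
    · rw [gc, hc])
  refine ⟨⟨fun z => H (z, 1), by fun_prop⟩, fun d => ?_, fun d => ?_, fun d hd t => ?_⟩
  · exact (hH (d, 0) (Or.inr (Or.inl rfl)) 1).trans (gb d 1)
  · exact (hH (d, 1) (Or.inr (Or.inr rfl)) 1).trans (gc d 1)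
  · exact (hH (d, t) (Or.inl hd) 1).trans (gA d hd t 1)

end HomotopyExtension

section Cubes

theorem isClosed_cubeBoundary (n : ℕ) : IsClosed (Cube.boundary (Fin n)) := by
  have : Cube.boundary (Fin n) = ⋃ i, {y : Fin n → I | y i = 0 ∨ y i = 1} := by
    ext y; simp [Cube.boundary]
  rw [this]
  exact isClosed_iUnion_of_finite fun i =>
    (isClosed_eq (continuous_apply i) continuous_const).union
      (isClosed_eq (continuous_apply i) continuous_const)

/-- The point of `[-1, 1]ⁿ` that corresponds to a point of the cube. -/
def centered {n : ℕ} (x : Fin n → I) : Fin n → ℝ := fun i => 2 * (x i : ℝ) - 1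

theorem norm_centered_le {n : ℕ} (x : Fin n → I) : ‖centered x‖ ≤ 1 := by
  refine (pi_norm_le_iff_of_nonneg zero_le_one).2 fun i => ?_
  have h0 := (x i).2.1
  have h1 := (x i).2.2
  exact abs_le.2 ⟨by simp only [centered]; linarith, by simp only [centered]; linarith⟩

theorem norm_centered_of_mem_boundary {n : ℕ} {x : Fin n → I} (hx : x ∈ Cube.boundary (Fin n)) :
    ‖centered x‖ = 1 := by
  refine le_antisymm (norm_centered_le x) ?_
  obtain ⟨i, hi⟩ := hx
  refine le_trans (le_of_eq ?_) (norm_le_pi_norm (centered x) i)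
  rcases hi with hi | hi <;> norm_num [centered, hi]

/-- The retraction of `Iⁿ × I` is the projection from the point over the centre of the cube at
height `2`. -/
theorem hasHEP_cubeBoundary (n : ℕ) : HasHEP (Cube.boundary (Fin n)) := by
  let M : (Fin n → I) × I → ℝ := fun z => max ‖centered z.1‖ ((2 - (z.2 : ℝ)) / 2)
  have hM : Continuous M := by
    unfold M centered
    fun_prop
  have hM0 : ∀ z, 0 < M z := fun z => by
    have h1 := z.2.2.2
    exact lt_of_lt_of_le (by linarith) (le_max_right _ _)
  have hMne : ∀ z, M z ≠ 0 := fun z => (hM0 z).ne'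
  let P : ℝ → I := Set.projIcc 0 1 zero_le_one
  have hP : Continuous P := continuous_projIcc
  have hPv : ∀ {a : ℝ} (h : a ∈ Set.Icc (0 : ℝ) 1), ((P a : I) : ℝ) = a := fun h =>
    congrArg Subtype.val (Set.projIcc_of_mem zero_le_one h)
  refine ⟨⟨fun z => (fun i => P ((1 + (2 * (z.1 i : ℝ) - 1) / M z) / 2),
    P (2 - (2 - (z.2 : ℝ)) / M z)), ?_⟩, fun z => ?_, fun z hz => ?_⟩
  · fun_prop (disch := exact hMne _)
  · rcases le_total ‖centered z.1‖ ((2 - (z.2 : ℝ)) / 2) with h | h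
    · left
      have hMz : M z = (2 - (z.2 : ℝ)) / 2 := max_eq_right h
      have h0 := hM0 z
      rw [hMz] at h0
      have : 2 - (2 - (z.2 : ℝ)) / M z = 0 := by
        rw [hMz, div_div_cancel₀ (by linarith), sub_self]
      refine Subtype.ext ?_
      simp only [ContinuousMap.coe_mk, this]
      exact hPv ⟨le_rfl, zero_le_one⟩
    · right
      have hMz : M z = ‖centered z.1‖ := max_eq_left h
      have h0 := hM0 z
      rw [hMz] at h0
      obtain ⟨i, hi⟩ : ∃ i, ‖centered z.1‖ ≤ ‖centered z.1 i‖ := by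
        by_contra! hlt
        exact lt_irrefl _ ((pi_norm_lt_iff h0).2 hlt)
      have hi' : |2 * (z.1 i : ℝ) - 1| = ‖centered z.1‖ :=
        le_antisymm (norm_le_pi_norm (centered z.1) i) hi
      refine ⟨i, ?_⟩
      rcases abs_choice (2 * (z.1 i : ℝ) - 1) with hc | hc <;> rw [hc] at hi'
      · right
        have : (1 + (2 * (z.1 i : ℝ) - 1) / M z) / 2 = 1 := by
          rw [hMz, hi', div_self h0.ne']
          norm_num
        refine Subtype.ext ?_
        simp only [ContinuousMap.coe_mk, this]
        exact hPv ⟨zero_le_one, le_rfl⟩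
      · left
        have : (1 + (2 * (z.1 i : ℝ) - 1) / M z) / 2 = 0 := by
          rw [hMz, ← hi', div_neg, div_self (by intro h'; rw [h'] at hi'; simp [← hi'] at h0)]
          norm_num
        refine Subtype.ext ?_
        simp only [ContinuousMap.coe_mk, this]
        exact hPv ⟨le_rfl, zero_le_one⟩
  · have hMz : M z = 1 := by
      have h1 := z.2.2.1
      rcases hz with h | h
      · have : ((2 - (z.2 : ℝ)) / 2) = 1 := by simp [h]
        exact (congrArg (max _) this).trans (max_eq_right (norm_centered_le _))
      · exact (congrArg (max · _) (norm_centered_of_mem_boundary h)).trans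
          (max_eq_left (by linarith))
    refine Prod.ext (funext fun i => Subtype.ext ?_) (Subtype.ext ?_)
    · have : (1 + (2 * (z.1 i : ℝ) - 1) / M z) / 2 = z.1 i := by rw [hMz]; ring
      simp only [ContinuousMap.coe_mk, this]
      exact hPv (z.1 i).2
    · have : 2 - (2 - (z.2 : ℝ)) / M z = z.2 := by rw [hMz]; ring
      simp only [ContinuousMap.coe_mk, this]
      exact hPv z.2.2

/-- The homeomorphism `Iⁿ × I ≃ Iⁿ⁺¹` that puts the last factor first. -/
def cubeSucc (n : ℕ) : (Fin n → I) × I ≃ₜ (Fin (n + 1) → I) where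
  toFun z := Fin.cons z.2 z.1
  invFun y := (Fin.tail y, y 0)
  left_inv z := by simp
  right_inv y := by simp
  continuous_toFun := by
    refine continuous_pi fun i => ?_
    refine Fin.cases ?_ (fun j => ?_) i
    · exact continuous_snd
    · exact (continuous_apply j).comp continuous_fst
  continuous_invFun := by
    unfold Fin.tail
    fun_prop

theorem cubeSucc_mem_boundary {n : ℕ} (z : (Fin n → I) × I) :
    cubeSucc n z ∈ Cube.boundary (Fin (n + 1)) ↔ z ∈ prismBoundary (Cube.boundary (Fin n)) := by
  change (∃ i, (Fin.cons z.2 z.1 : Fin (n + 1) → I) i = 0 ∨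
    (Fin.cons z.2 z.1 : Fin (n + 1) → I) i = 1) ↔ (∃ i, z.1 i = 0 ∨ z.1 i = 1) ∨ z.2 = 0 ∨ z.2 = 1
  simp only [Fin.exists_fin_succ, Fin.cons_zero, Fin.cons_succ]
  exact or_comm

theorem hasHEP_prismBoundary (n : ℕ) : HasHEP (prismBoundary (Cube.boundary (Fin n))) :=
  (hasHEP_cubeBoundary (n + 1)).of_homeomorph (cubeSucc n).symm fun d => by
    rw [← cubeSucc_mem_boundary, Homeomorph.apply_symm_apply]

theorem hasHEP_prismBoundary_prismBoundary (n : ℕ) :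
    HasHEP (prismBoundary (prismBoundary (Cube.boundary (Fin n)))) :=
  (hasHEP_prismBoundary (n + 1)).of_homeomorph
    ((cubeSucc n).symm.prodCongr (Homeomorph.refl I)) fun d => by
      refine or_congr ?_ Iff.rfl
      change (cubeSucc n).symm d.1 ∈ prismBoundary _ ↔ _
      rw [← cubeSucc_mem_boundary, Homeomorph.apply_symm_apply]

end Cubes

/-! ### Compression of maps of cubes along a connected map -/

section Compression

variable {D D' X Y : Type*} [TopologicalSpace D] [TopologicalSpace D'] [TopologicalSpace X]
  [TopologicalSpace Y]

/-- A map `v : D → Y` that equals `f ∘ a` on `A` is compressible if `a` extends to a map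
`b : D → X` such that `f ∘ b` is homotopic to `v` relative to `A`. -/
def Compressible (f : C(X, Y)) (A : Set D) (a : D → X) (v : C(D, Y)) : Prop :=
  ∃ (b : C(D, X)) (H : C(D × I, Y)), (∀ d ∈ A, b d = a d) ∧ (∀ d, H (d, 0) = f (b d)) ∧
    (∀ d, H (d, 1) = v d) ∧ ∀ d ∈ A, ∀ t, H (d, t) = f (a d)

theorem Compressible.congr {f : C(X, Y)} {A : Set D} {a a' : D → X} {v v' : C(D, Y)}
    (h : Compressible f A a v) (ha : ∀ d ∈ A, a d = a' d) (hv : ∀ d, v d = v' d) :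
    Compressible f A a' v' := by
  obtain ⟨b, H, h1, h2, h3, h4⟩ := h
  exact ⟨b, H, fun d hd => (h1 d hd).trans (ha d hd), h2, fun d => (h3 d).trans (hv d),
    fun d hd t => by rw [h4 d hd, ha d hd]⟩

theorem Compressible.of_homeomorph {f : C(X, Y)} {A : Set D} {A' : Set D'} {a : D' → X}
    {v : C(D', Y)} (e : D ≃ₜ D') (he : ∀ d, e d ∈ A' ↔ d ∈ A)
    (h : Compressible f A (a ∘ e) (v.comp e)) : Compressible f A' a v := by
  obtain ⟨b, H, h1, h2, h3, h4⟩ := h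
  have he' : ∀ d ∈ A', e.symm d ∈ A := fun d hd => by rwa [← he, e.apply_symm_apply]
  refine ⟨b.comp e.symm, ⟨fun z => H (e.symm z.1, z.2), by fun_prop⟩, fun d hd => ?_, fun d => ?_,
    fun d => ?_, fun d hd t => ?_⟩
  · simpa using h1 _ (he' d hd)
  · simpa using h2 (e.symm d)
  · simpa using h3 (e.symm d)
  · simpa using h4 _ (he' d hd) t

/-- Compressibility is invariant under homotopies of `v` and of its lift over `A`. -/
theorem Compressible.of_homotopy {f : C(X, Y)} {A : Set D} (hA : IsClosed A) (hep : HasHEP A)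
    (hep' : HasHEP (prismBoundary A)) {α : D × I → X} (hα : ContinuousOn α {z | z.1 ∈ A})
    (ν : C(D × I, Y)) (hν : ∀ d ∈ A, ∀ t, ν (d, t) = f (α (d, t)))
    (h : Compressible f A (fun d => α (d, 1)) (ν.comp ⟨fun d => (d, 1), by fun_prop⟩)) :
    Compressible f A (fun d => α (d, 0)) (ν.comp ⟨fun d => (d, 0), by fun_prop⟩) := by
  obtain ⟨b, H, h1, h2, h3, h4⟩ := h
  obtain ⟨B, hB0, hB⟩ := hep.exists_extension hA b (fun z => α (z.1, σ z.2))
    (hα.comp (by fun_prop) fun z hz => hz) (fun d hd => by simp [h1 d hd])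
  obtain ⟨H', g1, g2, g3⟩ := hep'.exists_moved_homotopy hA H (f.comp B)
    (ν.comp ⟨fun z => (z.1, σ z.2), by fun_prop⟩) (fun z => f (α (z.1, σ z.2.2)))
    (f.continuous.comp_continuousOn (hα.comp (by fun_prop) fun z hz => hz))
    (fun d hd s => by simp [hB d hd]) (fun d hd s => by simp [hν d hd])
    (fun d => by simp [h2, hB0]) (fun d => by simp [h3]) (fun d hd t => by simp [h4 d hd])
  refine ⟨B.comp ⟨fun d => (d, 1), by fun_prop⟩, H', fun d hd => ?_, fun d => ?_, fun d => ?_,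
    fun d hd t => ?_⟩
  · simp [hB d hd]
  · simp [g1]
  · simp [g2]
  · simp [g3 d hd]

/-- A problem whose lift over `A` extends over `D` reduces, by contracting `D`, to problems with
constant lift over `A`. -/
theorem Compressible.of_extension [ContractibleSpace D] [PathConnectedSpace X] {f : C(X, Y)}
    {A : Set D} (hA : IsClosed A) (hep : HasHEP A) (hep' : HasHEP (prismBoundary A)) (x : X)
    (w : C(D, X)) (v : C(D, Y)) (hv : ∀ d ∈ A, v d = f (w d))
    (h : ∀ v' : C(D, Y), (∀ d ∈ A, v' d = f x) → Compressible f A (fun _ => x) v') :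
    Compressible f A w v := by
  obtain ⟨κ⟩ : w.Homotopic (.const D x) := by
    obtain ⟨y, hy⟩ := (id_nullhomotopic D).comp_right w
    exact ContinuousMap.Homotopic.trans hy
      (ContinuousMap.homotopic_const_iff.2 (PathConnectedSpace.joined y x))
  let α : C(D × I, X) := ⟨fun z => κ (z.2, z.1), by fun_prop⟩
  obtain ⟨ν, hν0, hν⟩ := hep.exists_extension hA v (fun z => f (α z)) (by fun_prop)
    (fun d hd => by simp [α, hv d hd])
  refine (Compressible.of_homotopy hA hep hep' α.continuous.continuousOn ν hν ?_).congr
    (fun d _ => by simp [α]) (fun d => by simp [hν0])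
  refine (h _ fun d hd => by simp [hν d hd, α]).congr (fun d _ => by simp [α]) fun d => rfl

end Compression

section CompressibleCubes

instance : ContractibleSpace I :=
  (convex_Icc (0 : ℝ) 1).contractibleSpace ⟨0, le_rfl, zero_le_one⟩

instance (n : ℕ) : ContractibleSpace (Fin n → I) := by
  induction n with
  | zero => infer_instance
  | succ n ih => exact (cubeSucc n).symm.contractibleSpace

variable {X Y : Type*} [TopologicalSpace X] [TopologicalSpace Y] {f : C(X, Y)} {x : X}

/-- Surjectivity on homotopy groups, in terms of compression: `v` is a spheroid of `Y`. -/
theorem compressible_const_cube {n : ℕ} (hf : Function.Surjective (homotopyGroupMap n f x))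
    (v : C(Fin n → I, Y)) (hv : ∀ d ∈ Cube.boundary (Fin n), v d = f x) :
    Compressible f (Cube.boundary (Fin n)) (fun _ => x) v := by
  obtain ⟨b, hb⟩ := hf (Quotient.mk _ ⟨v, hv⟩)
  induction b using Quotient.inductionOn with | _ b
  obtain ⟨H⟩ : GenLoop.Homotopic (genLoopMap (Fin n) f x b) ⟨v, hv⟩ := Quotient.exact hb
  refine ⟨b.1, ⟨fun z => H (z.2, z.1), by fun_prop⟩, b.2, fun d => H.apply_zero d,
    fun d => H.apply_one d, fun d hd t => ?_⟩
  exact (H.eq_fst t hd).trans (congrArg f (b.2 d hd))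

/-- Injectivity on homotopy groups: a spheroid of `X` that is the end of a null-homotopy in `Y`
is the end of a null-homotopy in `X`. -/
theorem exists_nullhomotopy {n : ℕ} (hf : Function.Injective (homotopyGroupMap n f x))
    (u : C(Fin n → I, X)) (hu : ∀ d ∈ Cube.boundary (Fin n), u d = x) (v : C((Fin n → I) × I, Y))
    (hv0 : ∀ d, v (d, 0) = f x) (hv1 : ∀ d, v (d, 1) = f (u d))
    (hv : ∀ d ∈ Cube.boundary (Fin n), ∀ t, v (d, t) = f x) :
    ∃ w : C((Fin n → I) × I, X), (∀ d, w (d, 0) = x) ∧ (∀ d, w (d, 1) = u d) ∧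
      ∀ d ∈ Cube.boundary (Fin n), ∀ t, w (d, t) = x := by
  let c : GenLoop (Fin n) X x := GenLoop.const
  let u' : GenLoop (Fin n) X x := ⟨u, hu⟩
  have H : GenLoop.Homotopic (genLoopMap (Fin n) f x c) (genLoopMap (Fin n) f x u') :=
    ⟨{ toFun := fun z => v (z.2, z.1)
       map_zero_left := fun d => hv0 d
       map_one_left := fun d => hv1 d
       prop' := fun t d hd => hv d hd t }⟩
  obtain ⟨W⟩ : GenLoop.Homotopic c u' := Quotient.exact (@hf (Quotient.mk _ c) (Quotient.mk _ u')
    (Quotient.sound H))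
  exact ⟨⟨fun z => W (z.2, z.1), by fun_prop⟩, fun d => W.apply_zero d, fun d => W.apply_one d,
    fun d hd t => W.eq_fst t hd⟩

/-- Injectivity on `πₙ` and surjectivity on `πₙ₊₁` allow the compression of every map of an
`(n + 1)`-cube: the map `a` is first deformed to one that is constant on all faces but one. -/
theorem compressible_prism [PathConnectedSpace X] {n : ℕ}
    (hi : Function.Injective (homotopyGroupMap n f x))
    (hs : Function.Surjective (homotopyGroupMap (n + 1) f x)) (a : (Fin n → I) × I → X)
    (v : C((Fin n → I) × I, Y)) (ha : ContinuousOn a (prismBoundary (Cube.boundary (Fin n))))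
    (hv : ∀ d ∈ prismBoundary (Cube.boundary (Fin n)), v d = f (a d)) :
    Compressible f (prismBoundary (Cube.boundary (Fin n))) a v := by
  classical
  have hA := isClosed_cubeBoundary n
  have hA' := isClosed_prismBoundary hA
  have hep := hasHEP_cubeBoundary n
  have hep' := hasHEP_prismBoundary n
  have hep'' := hasHEP_prismBoundary_prismBoundary n
  set A := Cube.boundary (Fin n)
  have hconst : ∀ v' : C((Fin n → I) × I, Y), (∀ d ∈ prismBoundary A, v' d = f x) →
      Compressible f (prismBoundary A) (fun _ => x) v' := fun v' hv' =>
    Compressible.of_homeomorph (cubeSucc n).symm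
      (fun d => by rw [← cubeSucc_mem_boundary, Homeomorph.apply_symm_apply])
      (compressible_const_cube hs (v'.comp (cubeSucc n).symm) fun d hd => hv' _ <| by
        rw [← cubeSucc_mem_boundary]
        exact ((cubeSucc n).apply_symm_apply d).symm ▸ hd)
  -- If `a` is constant on all faces but the top one, the top face is a spheroid that bounds in `Y`,
  -- hence in `X`.
  have hopen : ∀ (a' : (Fin n → I) × I → X) (v' : C((Fin n → I) × I, Y)),
      ContinuousOn a' (prismBoundary A) → (∀ d ∈ prismBoundary A, v' d = f (a' d)) →
      (∀ d t, t = 0 ∨ d ∈ A → a' (d, t) = x) → Compressible f (prismBoundary A) a' v' := by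
    intro a' v' ha' hv' hx
    obtain ⟨w, hw0, hw1, hw⟩ := exists_nullhomotopy hi
      ⟨fun d => a' (d, 1), ha'.comp_continuous (by fun_prop) fun d => Or.inr (Or.inr rfl)⟩
      (fun d hd => hx _ _ (Or.inr hd)) v'
      (fun d => by rw [hv' _ (Or.inr (Or.inl rfl)), hx _ _ (Or.inl rfl)])
      (fun d => hv' _ (Or.inr (Or.inr rfl)))
      (fun d hd t => by rw [hv' _ (Or.inl hd), hx _ _ (Or.inr hd)])
    have hwa : ∀ z ∈ prismBoundary A, w z = a' z := by
      rintro ⟨d, t⟩ (hd | rfl | rfl)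
      · rw [hw d hd, hx _ _ (Or.inr hd)]
      · rw [hw0, hx _ _ (Or.inl rfl)]
      · exact hw1 d
    exact (Compressible.of_extension hA' hep' hep'' x w v'
      (fun d hd => by rw [hv' d hd, hwa d hd]) hconst).congr hwa fun _ => rfl
  -- The faces other than the top one form a contractible set, on which `a` is deformed to `x`.
  obtain ⟨ρ, hρ, hρ'⟩ := id hep
  have hρA : ∀ z, ρ z ∈ prismBoundary A := fun z =>
    (hρ z).elim (fun h => Or.inr (Or.inl h)) Or.inl
  obtain ⟨κ⟩ : (⟨fun z => a (ρ z), ha.comp_continuous ρ.continuous hρA⟩ :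
      C((Fin n → I) × I, X)).Homotopic (.const _ x) := by
    obtain ⟨y, hy⟩ := (id_nullhomotopic ((Fin n → I) × I)).comp_right
      ⟨fun z => a (ρ z), ha.comp_continuous ρ.continuous hρA⟩
    exact ContinuousMap.Homotopic.trans hy
      (ContinuousMap.homotopic_const_iff.2 (PathConnectedSpace.joined y x))
  have hκ0 : ∀ z, z.2 = 0 ∨ z.1 ∈ A → κ (0, z) = a z := fun z hz =>
    (κ.apply_zero z).trans (congrArg a (hρ' z hz))
  have hκ1 : ∀ z, κ (1, z) = x := fun z => κ.apply_one z
  obtain ⟨τ, hτ0, hτ⟩ := hep.exists_extension hA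
    ⟨fun d => a (d, 1), ha.comp_continuous (by fun_prop) fun d => Or.inr (Or.inr rfl)⟩
    (fun z => κ (z.2, (z.1, 1))) (by fun_prop) (fun d hd => hκ0 (d, 1) (Or.inr hd))
  let α : ((Fin n → I) × I) × I → X := fun z =>
    if z.1.2 = 0 ∨ z.1.1 ∈ A then κ (z.2, z.1) else τ (z.1.1, z.2)
  have hα1 : ∀ z s, z.2 = 0 ∨ z.1 ∈ A → α (z, s) = κ (s, z) := fun z s hz => if_pos hz
  have hα2 : ∀ d s, α ((d, 1), s) = τ (d, s) := fun d s => by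
    by_cases hd : d ∈ A
    · rw [hα1 _ _ (Or.inr hd), hτ d hd]
    · simp [α, hd]
  have hα : ContinuousOn α {z | z.1 ∈ prismBoundary A} := by
    have hJ : IsClosed {z : ((Fin n → I) × I) × I | z.1.2 = 0 ∨ z.1.1 ∈ A} :=
      (isClosed_eq (by fun_prop) continuous_const).union (hA.preimage (by fun_prop))
    have hT : IsClosed {z : ((Fin n → I) × I) × I | z.1.2 = 1} :=
      isClosed_eq (by fun_prop) continuous_const
    refine (ContinuousOn.union_of_isClosed (s := {z | z.1.2 = 0 ∨ z.1.1 ∈ A})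
      (t := {z | z.1.2 = 1}) ?_ ?_ hJ hT).mono ?_
    · exact ContinuousOn.congr (f := fun z : ((Fin n → I) × I) × I => κ (z.2, z.1)) (by fun_prop)
        fun z hz => hα1 _ _ hz
    · refine ContinuousOn.congr (f := fun z : ((Fin n → I) × I) × I => τ (z.1.1, z.2))
        (by fun_prop) ?_
      rintro ⟨⟨d, t⟩, s⟩ (rfl : t = 1)
      exact hα2 d s
    · rintro z (h | h | h)
      · exact Or.inl (Or.inr h)
      · exact Or.inl (Or.inl h)
      · exact Or.inr h
  have hα0 : ∀ z ∈ prismBoundary A, α (z, 0) = a z := by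
    rintro ⟨d, t⟩ (hd | rfl | rfl)
    · rw [hα1 _ _ (Or.inr hd), hκ0 _ (Or.inr hd)]
    · rw [hα1 _ _ (Or.inl rfl), hκ0 _ (Or.inl rfl)]
    · rw [hα2, hτ0]
      rfl
  obtain ⟨ν, hν0, hν⟩ := hep'.exists_extension hA' v (fun z => f (α z))
    (f.continuous.comp_continuousOn hα) (fun d hd => by rw [hv d hd, hα0 d hd])
  refine (Compressible.of_homotopy hA' hep' hep'' hα ν hν ?_).congr hα0 hν0
  refine hopen _ _ (hα.comp (by fun_prop) fun z hz => hz) (fun d hd => hν d hd 1) ?_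
  intro d t h
  rw [hα1 _ _ h, hκ1]

theorem compressible_cube [PathConnectedSpace X] {n : ℕ}
    (hi : ∀ m, m + 1 = n → Function.Injective (homotopyGroupMap m f x))
    (hs : Function.Surjective (homotopyGroupMap n f x)) (a : (Fin n → I) → X)
    (v : C(Fin n → I, Y)) (ha : ContinuousOn a (Cube.boundary (Fin n)))
    (hv : ∀ d ∈ Cube.boundary (Fin n), v d = f (a d)) :
    Compressible f (Cube.boundary (Fin n)) a v := by
  cases n with
  | zero =>
    have he : ∀ d, d ∉ Cube.boundary (Fin 0) := fun d ⟨i, _⟩ => i.elim0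
    exact (compressible_const_cube hs v fun d hd => (he d hd).elim).congr
      (fun d hd => (he d hd).elim) fun _ => rfl
  | succ n =>
    refine Compressible.of_homeomorph (cubeSucc n) cubeSucc_mem_boundary
      (compressible_prism (hi n rfl) hs _ _ ?_ ?_)
    · exact ha.comp (cubeSucc n).continuous.continuousOn fun z hz =>
        (cubeSucc_mem_boundary z).2 hz
    · exact fun d hd => hv _ ((cubeSucc_mem_boundary d).2 hd)

end CompressibleCubes

/-! ### Lifting properties and the mapping path space -/

section Lifting

variable {D D' B E : Type*} [TopologicalSpace D] [TopologicalSpace D'] [TopologicalSpace B]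
  [TopologicalSpace E]

/-- The map `p` has the right lifting property with respect to the inclusion of `A` in `D`. Partial
lifts are encoded as functions on `D` that are continuous on `A`. -/
def HasLift (p : C(E, B)) (A : Set D) : Prop :=
  ∀ (v : C(D, B)) (u : D → E), ContinuousOn u A → (∀ d ∈ A, p (u d) = v d) →
    ∃ w : C(D, E), (∀ d, p (w d) = v d) ∧ ∀ d ∈ A, w d = u d

/-- Lifting properties pass to quotients `(D', A')` of `(D, A)` that identify only points
of `A`. -/
theorem HasLift.of_relativeHomeomorph [CompactSpace D] [T2Space D'] {p : C(E, B)} {A : Set D}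
    {A' : Set D'} (h : HasLift p A) (φ : C(D, D')) (hφ : Function.Surjective φ)
    (hA : ∀ d, φ d ∈ A' ↔ d ∈ A) (hinj : ∀ d d', d ∉ A → d' ∉ A → φ d = φ d' → d = d') :
    HasLift p A' := by
  intro v u hu hv
  obtain ⟨w, hw, hwu⟩ := h (v.comp φ) (u ∘ φ)
    (hu.comp φ.continuous.continuousOn fun d hd => (hA d).2 hd) fun d hd => hv _ ((hA d).2 hd)
  have hq : Topology.IsQuotientMap φ := φ.continuous.isClosedMap.isQuotientMap φ.continuous hφ
  have hwφ : ∀ d d', φ d = φ d' → w d = w d' := by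
    intro d d' hdd
    by_cases hd : d ∈ A
    · have hd' : d' ∈ A := by rwa [← hA, ← hdd, hA]
      rw [hwu d hd, hwu d' hd', Function.comp_apply, hdd, Function.comp_apply]
    · have hd' : d' ∉ A := by rwa [← hA, ← hdd, hA]
      rw [hinj d d' hd hd' hdd]
  refine ⟨hq.lift w fun d d' hdd => hwφ d d' hdd, fun d' => ?_, fun d' hd' => ?_⟩
  · obtain ⟨d, rfl⟩ := hφ d'
    exact (congrArg p (DFunLike.congr_fun (hq.lift_comp w fun d d' hdd => hwφ d d' hdd) d)).trans
      (hw d)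
  · obtain ⟨d, rfl⟩ := hφ d'
    exact (DFunLike.congr_fun (hq.lift_comp w fun d d' hdd => hwφ d d' hdd) d).trans
      (hwu d ((hA d).1 hd'))

theorem HasLift.of_homeomorph {p : C(E, B)} {A : Set D} {A' : Set D'} (h : HasLift p A)
    (e : D ≃ₜ D') (he : ∀ d, e d ∈ A' ↔ d ∈ A) : HasLift p A' := by
  intro v u hu hv
  obtain ⟨w, hw, hwu⟩ := h (v.comp e) (u ∘ e)
    (hu.comp e.continuous.continuousOn fun d hd => (he d).2 hd) fun d hd => hv _ ((he d).2 hd)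
  refine ⟨w.comp e.symm, fun d => ?_, fun d hd => ?_⟩
  · simpa using hw (e.symm d)
  · simpa using hwu (e.symm d) (by rwa [← he, e.apply_symm_apply])

end Lifting

section PathSpace

variable {X Y : Type*} [TopologicalSpace X] [TopologicalSpace Y]

/-- The mapping path space of `f : X → Y`: the points of `X` with a path in `Y` that starts at their
image. -/
abbrev PathSpace (f : C(X, Y)) : Type _ := {z : X × C(I, Y) // z.2 0 = f z.1}

namespace PathSpace

variable (f : C(X, Y))

/-- The end point of the path. -/
def endpoint : C(PathSpace f, Y) := ⟨fun z => z.1.2 1, by fun_prop⟩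

/-- The projection of the mapping path space to the source of the map. -/
def source : C(PathSpace f, X) := ⟨fun z => z.1.1, by fun_prop⟩

/-- The inclusion of the source in the mapping path space by constant paths. -/
def const : C(X, PathSpace f) :=
  ⟨fun x => ⟨(x, ContinuousMap.const I (f x)), rfl⟩, by
    have : Continuous fun x : X => ContinuousMap.const I (f x) :=
      ContinuousMap.continuous_const'.comp f.continuous
    fun_prop⟩

variable {f} {D : Type*} [TopologicalSpace D] {A : Set D}

/-- A point of the path space attached to a map and a homotopy. -/
def ofHomotopy (b : C(D, X)) (H : C(D × I, Y)) (h : ∀ d, H (d, 0) = f (b d)) :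
    C(D, PathSpace f) :=
  ⟨fun d => ⟨(b d, H.curry d), h d⟩, by fun_prop⟩

theorem continuousOn_eval {u : D → PathSpace f} (hu : ContinuousOn u A) :
    ContinuousOn (fun z : D × I => (u z.1).1.2 z.2) {z | z.1 ∈ A} := by
  have h1 : ContinuousOn (fun z : D × I => (u z.1).1.2) {z | z.1 ∈ A} :=
    (continuous_snd.comp continuous_subtype_val).comp_continuousOn
      (hu.comp continuous_fst.continuousOn fun z hz => hz)
  exact h1.eval continuous_snd.continuousOn

/-- Lifts over `A` extend by homotopy extension, applied to the paths. -/
theorem hasLift_source (hA : IsClosed A) (hep : HasHEP A) : HasLift (source f) A := by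
  intro v u hu hv
  obtain ⟨H, hH0, hH⟩ := hep.exists_extension hA (f.comp v) _ (continuousOn_eval hu)
    (fun d hd => by
      rw [(u d).2]
      exact congrArg f (hv d hd))
  refine ⟨ofHomotopy v H hH0, fun d => rfl, fun d hd => Subtype.ext (Prod.ext ?_ ?_)⟩
  · exact (hv d hd).symm
  · exact ContinuousMap.ext fun t => hH d hd t

/-- Compression of maps from `(D, A)` along `f` amounts to a lifting property of the end point
map. -/
theorem hasLift_endpoint (hA : IsClosed A) (hep : HasHEP A) (hep' : HasHEP (prismBoundary A))
    (hf : ∀ (a : D → X) (v : C(D, Y)), ContinuousOn a A → (∀ d ∈ A, v d = f (a d)) →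
      Compressible f A a v) :
    HasLift (endpoint f) A := by
  intro v u hu hv
  have hk := continuousOn_eval hu
  obtain ⟨H, hH0, hH⟩ := hep.exists_extension hA v (fun z => (u z.1).1.2 (σ z.2))
    (hk.comp (f := fun z : D × I => (z.1, σ z.2)) (by fun_prop) fun z hz => hz)
    (fun d hd => by simpa [endpoint] using hv d hd)
  obtain ⟨b, H₀, h1, h2, h3, h4⟩ := hf (fun d => (u d).1.1)
    (H.comp ⟨fun d => (d, 1), by fun_prop⟩)
    ((source f).continuous.comp_continuousOn hu) (fun d hd => by simp [hH d hd, (u d).2])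
  obtain ⟨H₁, g1, g2, g3⟩ := hep'.exists_moved_homotopy hA H₀
    ⟨fun z => f (b z.1), by fun_prop⟩ ⟨fun z => H (z.1, σ z.2), by fun_prop⟩
    (fun z => (u z.1).1.2 (z.2.1 * z.2.2))
    (hk.comp (f := fun z : D × I × I => (z.1, z.2.1 * z.2.2)) (by fun_prop) fun z hz => hz)
    (fun d hd s => by simp [h1 d hd, (u d).2]) (fun d hd s => by simp [hH d hd])
    (fun d => by simp [h2]) (fun d => by simp [h3]) (fun d hd t => by simp [h4 d hd, (u d).2])
  refine ⟨ofHomotopy b H₁ fun d => g1 d, fun d => ?_, fun d hd => Subtype.ext (Prod.ext ?_ ?_)⟩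
  · exact (g2 d).trans (by simp [hH0])
  · exact h1 d hd
  · exact ContinuousMap.ext fun t => (g3 d hd t).trans (by simp)

end PathSpace

/-- The end point fibration of a `q`-connected map lifts cells up to dimension `q + 1`. -/
theorem IsQConnectedMap.hasLift_endpoint [PathConnectedSpace X] {f : C(X, Y)} {x : X} {q : ℕ}
    (hf : IsQConnectedMap q f x) {n : ℕ} (hn : n ≤ q + 1) :
    HasLift (PathSpace.endpoint f) (Cube.boundary (Fin n)) := by
  refine PathSpace.hasLift_endpoint (isClosed_cubeBoundary n) (hasHEP_cubeBoundary n)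
    (hasHEP_prismBoundary n) fun a v ha hv => compressible_cube (x := x) ?_ ?_ a v ha hv
  · rintro m rfl
    exact (hf.1 m (by omega)).1
  · rcases Nat.lt_or_ge q n with h | h
    · obtain rfl : n = q + 1 := by omega
      exact hf.2
    · exact (hf.1 n h).2

end PathSpace

/-! ### Lifting of simplices and prisms -/

section Simplices

theorem face_succAbove {n : ℕ} (i : Fin (n + 2)) (x : Simplex n) (a : Fin (n + 1)) :
    face i x (i.succAbove a) = x a := by
  change FunOnFinite.linearMap ℝ ℝ i.succAbove x (i.succAbove a) = x a
  rw [FunOnFinite.linearMap_apply_apply,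
    Finset.sum_eq_single a (fun b hb hba => (hba (by simpa using hb)).elim) (by simp)]

theorem face_self {n : ℕ} (i : Fin (n + 2)) (x : Simplex n) : face i x i = 0 := by
  change FunOnFinite.linearMap ℝ ℝ i.succAbove x i = 0
  rw [FunOnFinite.linearMap_apply_apply]
  refine Finset.sum_eq_zero fun b hb => ?_
  simp at hb

theorem face_injective {n : ℕ} (i : Fin (n + 2)) : Function.Injective (face i) := fun x y h =>
  stdSimplex.ext <| funext fun a => by rw [← face_succAbove i x, h, face_succAbove]

theorem exists_eq_face {n : ℕ} {i : Fin (n + 2)} {z : Simplex (n + 1)} (h : z i = 0) :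
    ∃ x, z = face i x := by
  have hs : ∑ a, z (i.succAbove a) = 1 := by
    have := stdSimplex.sum_eq_one z
    rwa [Fin.sum_univ_succAbove _ i, h, zero_add] at this
  refine ⟨⟨fun a => z (i.succAbove a), fun a => stdSimplex.zero_le z _, hs⟩,
    stdSimplex.ext (funext fun a => ?_)⟩
  rcases Fin.eq_self_or_eq_succAbove i a with rfl | ⟨b, rfl⟩
  · rw [h, face_self]
  · rw [face_succAbove]
    rfl

/-- The intersection of two faces of a simplex is a common face of them. -/
theorem exists_face_of_face_eq {n : ℕ} {i j : Fin (n + 2)} (hij : i ≤ j) {x x' : Simplex (n + 1)}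
    (h : face j.succ x = face i.castSucc x') : ∃ y, x = face i y ∧ x' = face j y := by
  have hi : x i = 0 := by
    rw [← face_succAbove j.succ x i, h,
      Fin.succAbove_of_castSucc_lt _ _ (Fin.castSucc_lt_succ_iff.2 hij), face_self]
  obtain ⟨y, rfl⟩ := exists_eq_face hi
  refine ⟨y, rfl, face_injective i.castSucc ?_⟩
  rw [← h]
  exact DFunLike.congr_fun (face_comp_face hij) y

/-- The boundary of the standard simplex. -/
def simplexBoundary (n : ℕ) : Set (Simplex n) := {x | ∃ i, x i = 0}

theorem isClosed_simplexBoundary (n : ℕ) : IsClosed (simplexBoundary n) := by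
  have : simplexBoundary n = ⋃ i, {x : Simplex n | x i = 0} := by
    ext; simp [simplexBoundary]
  rw [this]
  exact isClosed_iUnion_of_finite fun i =>
    isClosed_eq ((continuous_apply i).comp continuous_subtype_val) continuous_const

theorem notMem_simplexBoundary_zero (x : Simplex 0) : x ∉ simplexBoundary 0 := by
  rintro ⟨i, hi⟩
  simp at hi

theorem face_mem_simplexBoundary {n : ℕ} (i : Fin (n + 2)) (x : Simplex n) :
    face i x ∈ simplexBoundary (n + 1) := ⟨i, face_self i x⟩

/-- The point `(t, (1 - t) x)` of the cone over a simplex. -/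
def conePoint {n : ℕ} (x : Simplex n) (t : I) : Simplex (n + 1) :=
  ⟨Fin.cons (t : ℝ) fun a => (1 - (t : ℝ)) * x a, by
    refine ⟨fun i => ?_, ?_⟩
    · refine Fin.cases ?_ (fun a => ?_) i
      · exact t.2.1
      · exact mul_nonneg (sub_nonneg.2 t.2.2) (stdSimplex.zero_le x a)
    · rw [Fin.sum_univ_succ]
      simp [← Finset.mul_sum]⟩

@[simp]
theorem conePoint_zero {n : ℕ} (x : Simplex n) (t : I) : conePoint x t 0 = t := rfl

@[simp]
theorem conePoint_succ {n : ℕ} (x : Simplex n) (t : I) (a : Fin (n + 1)) :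
    conePoint x t a.succ = (1 - (t : ℝ)) * x a := rfl

theorem continuous_conePoint (n : ℕ) :
    Continuous fun z : Simplex n × I => conePoint z.1 z.2 := by
  refine Continuous.subtype_mk (continuous_pi fun i => ?_) _
  refine Fin.cases ?_ (fun a => ?_) i
  · exact continuous_subtype_val.comp continuous_snd
  · have : Continuous fun z : Simplex n × I => z.1 a :=
      (continuous_apply a).comp (continuous_subtype_val.comp continuous_fst)
    exact (continuous_const.sub (continuous_subtype_val.comp continuous_snd)).mul this

theorem conePoint_surjective {n : ℕ} (z : Simplex (n + 1)) : ∃ x t, conePoint x t = z := by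
  have hz := stdSimplex.sum_eq_one z
  rw [Fin.sum_univ_succ] at hz
  by_cases h1 : z 0 = 1
  · refine ⟨v₀ n, 1, stdSimplex.ext (funext fun i => ?_)⟩
    have h0 : ∀ a : Fin (n + 1), z a.succ = 0 := fun a =>
      (Finset.sum_eq_zero_iff_of_nonneg fun a _ => stdSimplex.zero_le z (Fin.succ a)).1
        (by linarith) a (Finset.mem_univ a)
    refine Fin.cases ?_ (fun a => ?_) i
    · simp [h1]
    · simp [h0]
  · have hlt : 0 < 1 - z 0 := sub_pos.2 (lt_of_le_of_ne (stdSimplex.le_one z 0) h1)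
    refine ⟨⟨fun a => z a.succ / (1 - z 0), fun a =>
      div_nonneg (stdSimplex.zero_le z _) hlt.le, ?_⟩,
      ⟨z 0, stdSimplex.zero_le z 0, stdSimplex.le_one z 0⟩, stdSimplex.ext (funext fun i => ?_)⟩
    · rw [← Finset.sum_div, div_eq_one_iff_eq hlt.ne']
      linarith
    · refine Fin.cases rfl (fun a => ?_) i
      exact mul_div_cancel₀ _ hlt.ne'

/-- The boundary of the product of a simplex and a cube. -/
def simplexCubeBoundary (n m : ℕ) : Set (Simplex n × (Fin m → I)) :=
  {z | z.1 ∈ simplexBoundary n ∨ z.2 ∈ Cube.boundary (Fin m)}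

theorem tail_mem_or_iff {m : ℕ} (y : Fin (m + 1) → I) :
    y ∈ Cube.boundary (Fin (m + 1)) ↔
      (y 0 = 0 ∨ y 0 = 1) ∨ Fin.tail y ∈ Cube.boundary (Fin m) := by
  change (∃ i, y i = 0 ∨ y i = 1) ↔ _ ∨ ∃ i, Fin.tail y i = 0 ∨ Fin.tail y i = 1
  rw [Fin.exists_fin_succ]
  rfl

variable {B E : Type*} [TopologicalSpace B] [TopologicalSpace E] {p : C(E, B)}

/-- Lifting properties for cubes give those for products of simplices and cubes: one coordinate of
the cube at a time is used to cone off the simplex. -/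
theorem hasLift_simplexCube {q : ℕ} (h : ∀ n ≤ q, HasLift p (Cube.boundary (Fin n))) (n : ℕ) :
    ∀ m, n + m ≤ q → HasLift p (simplexCubeBoundary n m) := by
  induction n with
  | zero =>
    intro m hm
    refine (h m (by omega)).of_homeomorph
      (Homeomorph.uniqueProd (Simplex 0) (Fin m → I)).symm fun d => ?_
    exact or_iff_right (notMem_simplexBoundary_zero _)
  | succ n ih =>
    intro m hm
    refine (ih (m + 1) (by omega)).of_relativeHomeomorph
      ⟨fun z => (conePoint z.1 (z.2 0), Fin.tail z.2), ?_⟩ ?_ ?_ ?_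
    · refine ((continuous_conePoint n).comp (f := fun z : Simplex n × (Fin (m + 1) → I) =>
        (z.1, z.2 0)) (by fun_prop)).prodMk ?_
      unfold Fin.tail
      fun_prop
    · rintro ⟨z, y⟩
      obtain ⟨x, t, rfl⟩ := conePoint_surjective z
      exact ⟨(x, Fin.cons t y), by simp⟩
    · rintro ⟨x, y⟩
      have hb : conePoint x (y 0) ∈ simplexBoundary (n + 1) ↔
          (y 0 = 0 ∨ y 0 = 1) ∨ x ∈ simplexBoundary n := by
        change (∃ i, conePoint x (y 0) i = 0) ↔ _ ∨ ∃ i, x i = 0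
        rw [Fin.exists_fin_succ]
        simp only [conePoint_zero, conePoint_succ, mul_eq_zero, sub_eq_zero, exists_or,
          Subtype.ext_iff (a1 := y 0), Set.Icc.coe_zero, Set.Icc.coe_one, eq_comm (a := (1 : ℝ)),
          exists_const]
        tauto
      change conePoint x (y 0) ∈ simplexBoundary (n + 1) ∨ Fin.tail y ∈ Cube.boundary (Fin m) ↔
        x ∈ simplexBoundary n ∨ y ∈ Cube.boundary (Fin (m + 1))
      rw [hb, tail_mem_or_iff]
      tauto
    · rintro ⟨x, y⟩ ⟨x', y'⟩ hd - hxy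
      obtain ⟨h1, h2⟩ := Prod.ext_iff.1 hxy
      have h0 : y 0 = y' 0 := Subtype.ext (DFunLike.congr_fun h1 0)
      have hy1 : (1 : ℝ) - y 0 ≠ 0 := fun h' => hd <| Or.inr ⟨0, Or.inr <|
        Subtype.ext (sub_eq_zero.1 h').symm⟩
      refine Prod.ext (stdSimplex.ext (funext fun a => mul_left_cancel₀ hy1 ?_)) ?_
      · have := DFunLike.congr_fun h1 a.succ
        simpa [← h0] using this
      · change y = y'
        rw [← Fin.cons_self_tail y, ← Fin.cons_self_tail y', h0]
        exact congrArg _ h2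

theorem hasLift_simplex {q : ℕ} (h : ∀ n ≤ q, HasLift p (Cube.boundary (Fin n))) {n : ℕ}
    (hn : n ≤ q) : HasLift p (simplexBoundary n) := by
  refine (hasLift_simplexCube h n 0 hn).of_homeomorph (Homeomorph.prodUnique _ _) fun d => ?_
  exact (or_iff_left fun ⟨i, _⟩ => i.elim0).symm

theorem hasLift_simplexPrism {q : ℕ} (h : ∀ n ≤ q, HasLift p (Cube.boundary (Fin n))) {n : ℕ}
    (hn : n + 1 ≤ q) : HasLift p (prismBoundary (simplexBoundary n)) := by
  refine (hasLift_simplexCube h n 1 hn).of_homeomorph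
    ((Homeomorph.refl _).prodCongr (Homeomorph.funUnique (Fin 1) I)) fun d => ?_
  refine or_congr Iff.rfl ⟨fun h => ⟨0, h⟩, ?_⟩
  rintro ⟨i, hi⟩
  rwa [Subsingleton.elim i 0] at hi

theorem exists_path_lift (h : HasLift p (Cube.boundary (Fin 1))) (e e' : E)
    (γ : Path (p e) (p e')) : ∃ δ : Path e e', δ.map p.continuous = γ := by
  classical
  have h' : HasLift p ({0, 1} : Set I) := h.of_homeomorph (Homeomorph.funUnique (Fin 1) I)
    fun d => ⟨fun h => ⟨0, h⟩, fun ⟨i, hi⟩ => by rwa [Subsingleton.elim i 0] at hi⟩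
  obtain ⟨w, hw, hwu⟩ := h' γ.toContinuousMap (fun t => if t = 0 then e else e')
    (Set.Finite.continuousOn (by simp) _) (by rintro d (rfl | rfl) <;> simp)
  exact ⟨⟨w, by simpa using hwu 0, by simpa using hwu 1⟩, Path.ext (funext hw)⟩

end Simplices

/-! ### Choices of lifts compatible with faces -/

section CompatibleLifts

variable {B E Y Z : Type*} [TopologicalSpace B] [TopologicalSpace E] [TopologicalSpace Y]
  [TopologicalSpace Z]

theorem isClosedEmbedding_face {n : ℕ} (i : Fin (n + 2)) :
    Topology.IsClosedEmbedding (face (n := n) i) :=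
  (face i).continuous.isClosedEmbedding (face_injective i)

/-- Maps on the faces of a simplex that agree on their intersections glue to a map on the
boundary. The factor `Y` is a parameter. -/
theorem exists_glued_boundary {n : ℕ} (w : Fin (n + 2) → C(Simplex n × Y, E))
    (hw : ∀ i j x x' y, face i x = face j x' → w i (x, y) = w j (x', y)) :
    ∃ u : Simplex (n + 1) × Y → E, ContinuousOn u {z | z.1 ∈ simplexBoundary (n + 1)} ∧
      ∀ i x y, u (face i x, y) = w i (x, y) := by
  classical
  let u : Simplex (n + 1) × Y → E := fun z =>
    if h : ∃ ix : Fin (n + 2) × Simplex n, face ix.1 ix.2 = z.1 then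
      w h.choose.1 (h.choose.2, z.2)
    else w 0 (v₀ n, z.2)
  have hu : ∀ i x y, u (face i x, y) = w i (x, y) := fun i x y => by
    have h : ∃ ix : Fin (n + 2) × Simplex n, face ix.1 ix.2 = face i x := ⟨(i, x), rfl⟩
    exact (dif_pos h).trans (hw _ _ _ _ _ h.choose_spec)
  refine ⟨u, ?_, hu⟩
  have hcover : {z : Simplex (n + 1) × Y | z.1 ∈ simplexBoundary (n + 1)} =
      ⋃ i : Fin (n + 2), Prod.map (face (n := n) i) (id : Y → Y) '' Set.univ := by
    ext ⟨z, y⟩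
    simp only [Set.mem_iUnion, Set.image_univ, Set.mem_range]
    constructor
    · rintro ⟨i, hi⟩
      obtain ⟨x, rfl⟩ := exists_eq_face hi
      exact ⟨i, (x, y), rfl⟩
    · rintro ⟨i, ⟨x, y'⟩, h⟩
      obtain ⟨rfl, -⟩ := Prod.ext_iff.1 h
      exact face_mem_simplexBoundary i x
  rw [hcover]
  have hemb : ∀ i : Fin (n + 2), Topology.IsClosedEmbedding
      (Prod.map (face (n := n) i) (id : Y → Y)) := fun i =>
    (isClosedEmbedding_face i).prodMap Topology.IsClosedEmbedding.id
  refine (locallyFinite_of_finite _).continuousOn_iUnion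
    (fun i => (hemb i).isClosedMap _ isClosed_univ) fun i => ?_
  rw [(hemb i).isInducing.continuousOn_image_iff]
  exact ((w i).continuous.congr fun z => (hu i z.1 z.2).symm).continuousOn

theorem exists_dependent_sequence {F : ℕ → Type*} {R : ∀ n, F n → F (n + 1) → Prop} (a : F 0)
    (h : ∀ n x, ∃ y, R n x y) : ∃ s : ∀ n, F n, ∀ n, R n (s n) (s (n + 1)) := by
  choose g hg using h
  exact ⟨fun n => Nat.rec a g n, fun n => hg n _⟩

/-- If two simplices share a face, their images under the operation `c` agree there. -/
def FaceCompatible : ∀ {n : ℕ}, (C(Simplex n, Z) → C(Simplex n × Y, E)) → Prop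
  | 0, _ => True
  | _ + 1, c => ∀ i j τ τ', τ.comp (face i) = τ'.comp (face j) →
      ∀ x y, c τ (face i x, y) = c τ' (face j x, y)

theorem FaceCompatible.eq_of_face_eq {n : ℕ} {c : C(Simplex n, Z) → C(Simplex n × Y, E)}
    (hc : FaceCompatible c) (τ : C(Simplex (n + 1), Z)) {i j : Fin (n + 2)} {x x' : Simplex n}
    (h : face i x = face j x') (y : Y) :
    c (τ.comp (face i)) (x, y) = c (τ.comp (face j)) (x', y) := by
  wlog hij : i ≤ j generalizing i j x x'
  · exact (this h.symm (le_of_not_ge hij)).symm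
  rcases hij.eq_or_lt with rfl | hij
  · rw [face_injective i h]
  cases n with
  | zero =>
    have h0 : face i x i = 0 := face_self i x
    have h1 : face i x j = 0 := by rw [h, face_self]
    have hs := stdSimplex.sum_eq_one (face i x)
    rw [Fin.sum_univ_succAbove _ i, h0, zero_add] at hs
    obtain ⟨b, rfl⟩ := Fin.exists_succAbove_eq hij.ne'
    rw [Fintype.sum_eq_single b fun b' hb => (hb (Subsingleton.elim b' b)).elim, h1] at hs
    exact (zero_ne_one hs).elim
  | succ n =>
    obtain ⟨j, rfl⟩ := Fin.exists_succ_eq.2 (Fin.ne_zero_of_lt hij)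
    obtain ⟨i, rfl⟩ := Fin.exists_castSucc_eq.2 (Fin.ne_last_of_lt hij)
    have hle : i ≤ j := Fin.castSucc_lt_succ_iff.1 hij
    obtain ⟨z, rfl, rfl⟩ := exists_face_of_face_eq hle h.symm
    refine (hc j i _ _ ?_ z y)
    rw [ContinuousMap.comp_assoc, ContinuousMap.comp_assoc, face_comp_face hle]

/-- If solutions of a lifting problem over the boundary of each simplex of dimension at most `q`
extend to the simplex, then solutions can be chosen for all these simplices, compatibly with
faces. -/
theorem exists_compatible_lifts [Nonempty E] {q : ℕ} (r : Z → Y → E → Prop)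
    (hr : ∀ n ≤ q, ∀ (τ : C(Simplex n, Z)) (u : Simplex n × Y → E),
      ContinuousOn u {z | z.1 ∈ simplexBoundary n} →
      (∀ x ∈ simplexBoundary n, ∀ y, r (τ x) y (u (x, y))) →
      ∃ w : C(Simplex n × Y, E), (∀ x y, r (τ x) y (w (x, y))) ∧
        ∀ x ∈ simplexBoundary n, ∀ y, w (x, y) = u (x, y)) :
    ∃ s : ∀ n, C(Simplex n, Z) → C(Simplex n × Y, E),
      (∀ n ≤ q, ∀ τ x y, r (τ x) y (s n τ (x, y))) ∧
      ∀ n, n + 1 ≤ q → ∀ τ i x y, s (n + 1) τ (face i x, y) = s n (τ.comp (face i)) (x, y) := by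
  classical
  let F : ℕ → Type _ := fun n => {c : C(Simplex n, Z) → C(Simplex n × Y, E) //
    n ≤ q → (∀ τ x y, r (τ x) y (c τ (x, y))) ∧ FaceCompatible c}
  have e₀ : E := Classical.arbitrary E
  have h0 : ∀ τ : C(Simplex 0, Z), ∃ w : C(Simplex 0 × Y, E), ∀ x y, r (τ x) y (w (x, y)) :=
    fun τ => by
      obtain ⟨w, hw, -⟩ := hr 0 (Nat.zero_le q) τ (fun _ => e₀) continuousOn_const
        fun x hx => (notMem_simplexBoundary_zero x hx).elim
      exact ⟨w, hw⟩
  choose c₀ hc₀ using h0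
  obtain ⟨s, hs⟩ := exists_dependent_sequence (F := F)
    (R := fun n c c' => n + 1 ≤ q →
      ∀ τ i x y, c'.1 τ (face i x, y) = c.1 (τ.comp (face i)) (x, y))
    ⟨c₀, fun _ => ⟨hc₀, trivial⟩⟩ (by
      rintro n ⟨c, hc⟩
      by_cases hn : n + 1 ≤ q
      · obtain ⟨hcr, hcf⟩ := hc (by omega)
        have hstep : ∀ τ : C(Simplex (n + 1), Z), ∃ w : C(Simplex (n + 1) × Y, E),
            (∀ x y, r (τ x) y (w (x, y))) ∧
            ∀ i x y, w (face i x, y) = c (τ.comp (face i)) (x, y) := by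
          intro τ
          obtain ⟨u, hu, hui⟩ := exists_glued_boundary (fun i => c (τ.comp (face i)))
            fun i j x x' y h => hcf.eq_of_face_eq τ h y
          obtain ⟨w, hw, hwu⟩ := hr (n + 1) hn τ u hu (by
            rintro x ⟨i, hi⟩ y
            obtain ⟨x, rfl⟩ := exists_eq_face hi
            rw [hui]
            exact hcr (τ.comp (face i)) x y)
          exact ⟨w, hw, fun i x y => by
            rw [hwu _ (face_mem_simplexBoundary i x), hui]⟩
        choose c' hc'r hc' using hstep
        refine ⟨⟨c', fun _ => ⟨hc'r, fun i j τ τ' h x y => ?_⟩⟩, fun _ => hc'⟩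
        rw [hc', hc', h]
      · exact ⟨⟨fun _ => ContinuousMap.const _ e₀, fun h => (hn h).elim⟩, fun h => (hn h).elim⟩)
  exact ⟨fun n => (s n).1, fun n hn => ((s n).2 hn).1, hs⟩

variable {p : C(E, B)}

/-- Lifts of all singular simplices of dimension at most `q`, compatible with faces. -/
theorem exists_section [Nonempty E] {q : ℕ}
    (h : ∀ n ≤ q, HasLift p (Cube.boundary (Fin n))) :
    ∃ s : ∀ n, C(Simplex n, B) → C(Simplex n, E), (∀ n ≤ q, ∀ τ, p.comp (s n τ) = τ) ∧
      ∀ n, n + 1 ≤ q → ∀ τ i, (s (n + 1) τ).comp (face i) = s n (τ.comp (face i)) := by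
  obtain ⟨s, hs, hs'⟩ := exists_compatible_lifts (q := q) (Y := Unit) (Z := B)
    (fun b _ e => p e = b) (by
      intro n hn τ u hu hv
      obtain ⟨w, hw, hwu⟩ := hasLift_simplex h hn τ (fun x => u (x, ()))
        (hu.comp (by fun_prop) fun x hx => hx) fun x hx => hv x hx _
      exact ⟨w.comp ContinuousMap.fst, fun x _ => hw x, fun x hx _ => hwu x hx⟩)
  refine ⟨fun n τ => (s n τ).comp ⟨fun x => (x, ()), by fun_prop⟩, fun n hn τ => ?_,
    fun n hn τ i => ?_⟩
  · exact ContinuousMap.ext fun x => hs n hn τ x _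
  · exact ContinuousMap.ext fun x => hs' n hn τ i x _

/-- Fibrewise homotopies between singular simplices of dimension less than `q` with the same image,
compatible with faces. -/
theorem exists_fibrewise_homotopies [Nonempty E] {q : ℕ}
    (h : ∀ n ≤ q, HasLift p (Cube.boundary (Fin n))) :
    ∃ K : ∀ n, C(Simplex n, {z : E × E // p z.1 = p z.2}) → C(Simplex n × I, E),
      (∀ n, n + 1 ≤ q → ∀ τ x t, p (K n τ (x, t)) = p (τ x).1.1) ∧
      (∀ n, n + 1 ≤ q → ∀ τ x, K n τ (x, 0) = (τ x).1.1 ∧ K n τ (x, 1) = (τ x).1.2) ∧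
      ∀ n, n + 2 ≤ q → ∀ τ i x t, K (n + 1) τ (face i x, t) = K n (τ.comp (face i)) (x, t) := by
  classical
  cases q with
  | zero =>
    exact ⟨fun _ _ => ContinuousMap.const _ (Classical.arbitrary E), by simp, by simp, by simp⟩
  | succ q =>
  obtain ⟨K, hK, hK'⟩ := exists_compatible_lifts (q := q) (Y := I)
    (Z := {z : E × E // p z.1 = p z.2})
    (fun z t e => p e = p z.1.1 ∧ (t = 0 → e = z.1.1) ∧ (t = 1 → e = z.1.2)) (by
      intro n hn τ u hu hv
      let u' : Simplex n × I → E := fun z =>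
        if z.2 = 0 then (τ z.1).1.1 else if z.2 = 1 then (τ z.1).1.2 else u z
      have hu0 : ∀ x, u' (x, 0) = (τ x).1.1 := fun x => by simp [u']
      have hu1 : ∀ x, u' (x, 1) = (τ x).1.2 := fun x => by simp [u']
      have hub : ∀ x ∈ simplexBoundary n, ∀ t, u' (x, t) = u (x, t) := fun x hx t => by
        simp only [u']
        split_ifs with h0 h1
        · exact ((hv x hx t).2.1 h0).symm
        · exact ((hv x hx t).2.2 h1).symm
        · rfl
      have hu' : ContinuousOn u' (prismBoundary (simplexBoundary n)) := by
        have cl0 : IsClosed {z : Simplex n × I | z.2 = 0} :=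
          isClosed_eq continuous_snd continuous_const
        have cl1 : IsClosed {z : Simplex n × I | z.2 = 1} :=
          isClosed_eq continuous_snd continuous_const
        refine (ContinuousOn.union_of_isClosed
          (s := {z : Simplex n × I | z.1 ∈ simplexBoundary n}) ?_
          (ContinuousOn.union_of_isClosed ?_ ?_ cl0 cl1)
          ((isClosed_simplexBoundary n).preimage continuous_fst) (cl0.union cl1))
        · exact hu.congr fun z hz => hub _ hz _
        · refine ContinuousOn.congr (f := fun z : Simplex n × I => (τ z.1).1.1) (by fun_prop) ?_
          rintro ⟨x, t⟩ (rfl : t = 0)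
          exact hu0 x
        · refine ContinuousOn.congr (f := fun z : Simplex n × I => (τ z.1).1.2) (by fun_prop) ?_
          rintro ⟨x, t⟩ (rfl : t = 1)
          exact hu1 x
      obtain ⟨w, hw, hwu⟩ := hasLift_simplexPrism h (Nat.succ_le_succ hn)
        ⟨fun z : Simplex n × I => p (τ z.1).1.1, by fun_prop⟩ u' hu' (by
          rintro ⟨x, t⟩ (hx | rfl | rfl)
          · rw [hub x hx]
            exact (hv x hx t).1
          · rw [hu0]
            rfl
          · rw [hu1]
            exact (τ x).2.symm)
      refine ⟨w, fun x t => ⟨hw (x, t), ?_, ?_⟩, fun x hx t => ?_⟩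
      · rintro rfl
        rw [hwu _ (Or.inr (Or.inl rfl)), hu0]
      · rintro rfl
        rw [hwu _ (Or.inr (Or.inr rfl)), hu1]
      · rw [hwu _ (Or.inl hx), hub x hx])
  refine ⟨K, fun n hn τ x t => (hK n (by omega) τ x t).1, fun n hn τ x => ⟨?_, ?_⟩,
    fun n hn => hK' n (by omega)⟩
  · exact (hK n (by omega) τ x 0).2.1 rfl
  · exact (hK n (by omega) τ x 1).2.2 rfl

end CompatibleLifts

end UnitInterval

/-! ### Labelled cochains and the prism operator -/

section LabelledCochains

/-- The alternating sum identity behind prism operators: `t i j` stands for the `j`-th face of the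
`i`-th simplex of a prism, and `u i j` for the `i`-th simplex of the prism over the `j`-th face. -/
theorem sum_prism_faces {M k : Type*} [AddCommGroup M] [CommRing k] [Module k M] (n : ℕ)
    (t u : ℕ → ℕ → M) (h1 : ∀ i j, i < n → j ≤ i → t (i + 1) j = u i j)
    (h2 : ∀ i, i < n → t (i + 1) (i + 1) = t i (i + 1))
    (h3 : ∀ i j, i < j → j ≤ n → t i (j + 1) = u i j) :
    ∑ i ∈ Finset.range (n + 1), (-1 : k) ^ i • ∑ j ∈ Finset.range (n + 2), (-1 : k) ^ j • t i j +
      ∑ j ∈ Finset.range (n + 1), (-1 : k) ^ j • ∑ i ∈ Finset.range n, (-1 : k) ^ i • u i j =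
    t 0 0 - t n (n + 1) := by
  have hT : ∀ i ∈ Finset.range (n + 1),
      (-1 : k) ^ i • ∑ j ∈ Finset.range (n + 2), (-1 : k) ^ j • t i j =
        ∑ j ∈ Finset.range i, (-1 : k) ^ (i + j) • t i j + (t i i - t i (i + 1)) +
          ∑ j ∈ Finset.range (n - i), (-1 : k) ^ j • t i (i + 2 + j) := by
    intro i hi
    have hi' : n + 2 = i + 2 + (n - i) := by
      have := Finset.mem_range.1 hi
      omega
    rw [hi', Finset.sum_range_add, Finset.sum_range_succ, Finset.sum_range_succ, smul_add,
      smul_add, smul_add, Finset.smul_sum, Finset.smul_sum, smul_smul, smul_smul]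
    have e1 : (-1 : k) ^ i * (-1) ^ i = 1 := by rw [← mul_pow]; simp
    have e2 : (-1 : k) ^ i * (-1) ^ (i + 1) = -1 := by rw [pow_succ, ← mul_assoc, e1]; simp
    rw [e1, e2, one_smul, neg_one_smul, add_assoc _ (t i i), ← sub_eq_add_neg]
    congr 1
    · congr 1
      exact Finset.sum_congr rfl fun j _ => by rw [smul_smul, pow_add]
    · refine Finset.sum_congr rfl fun j _ => ?_
      rw [smul_smul, pow_add, pow_add, ← mul_assoc, ← mul_assoc, e1]
      simp
  have hU : ∑ j ∈ Finset.range (n + 1), (-1 : k) ^ j • ∑ i ∈ Finset.range n, (-1 : k) ^ i • u i j =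
      ∑ i ∈ Finset.range n, (∑ j ∈ Finset.range (i + 1), (-1 : k) ^ (i + j) • u i j -
        ∑ j ∈ Finset.range (n - i), (-1 : k) ^ j • u i (i + 1 + j)) := by
    simp only [Finset.smul_sum, smul_smul]
    rw [Finset.sum_comm]
    refine Finset.sum_congr rfl fun i hi => ?_
    have hi' : n + 1 = i + 1 + (n - i) := by
      have := Finset.mem_range.1 hi
      omega
    rw [hi', Finset.sum_range_add, sub_eq_add_neg, ← Finset.sum_neg_distrib]
    congr 1
    · exact Finset.sum_congr rfl fun j _ => by rw [pow_add (-1 : k) i j, mul_comm]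
    · have e1 : (-1 : k) ^ i * (-1) ^ i = 1 := by rw [← mul_pow]; simp
      refine Finset.sum_congr rfl fun j _ => ?_
      rw [← neg_smul]
      congr 1
      rw [pow_add, pow_succ, mul_comm, ← mul_assoc, ← mul_assoc, e1]
      ring
  have hdiag : ∀ m ≤ n, ∑ i ∈ Finset.range (m + 1), (t i i - t i (i + 1)) =
      t 0 0 - t m (m + 1) := by
    intro m
    induction m with
    | zero => simp
    | succ m ih =>
      intro hm
      rw [Finset.sum_range_succ, ih (by omega), h2 m (by omega)]
      abel
  rw [Finset.sum_congr rfl hT, hU, Finset.sum_add_distrib, Finset.sum_add_distrib, hdiag n le_rfl,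
    Finset.sum_range_succ' (fun i => ∑ j ∈ Finset.range i, (-1 : k) ^ (i + j) • t i j),
    Finset.sum_range_succ (fun i => ∑ j ∈ Finset.range (n - i), (-1 : k) ^ j • t i (i + 2 + j)),
    Finset.sum_sub_distrib]
  have hA : ∑ i ∈ Finset.range n, ∑ j ∈ Finset.range (i + 1), (-1 : k) ^ (i + 1 + j) • t (i + 1) j =
      -∑ i ∈ Finset.range n, ∑ j ∈ Finset.range (i + 1), (-1 : k) ^ (i + j) • u i j := by
    rw [← Finset.sum_neg_distrib]
    refine Finset.sum_congr rfl fun i hi => ?_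
    rw [← Finset.sum_neg_distrib]
    refine Finset.sum_congr rfl fun j hj => ?_
    rw [h1 i j (Finset.mem_range.1 hi) (Nat.le_of_lt_succ (Finset.mem_range.1 hj)), ← neg_smul]
    congr 1
    ring
  have hC : ∑ i ∈ Finset.range n, ∑ j ∈ Finset.range (n - i), (-1 : k) ^ j • t i (i + 2 + j) =
      ∑ i ∈ Finset.range n, ∑ j ∈ Finset.range (n - i), (-1 : k) ^ j • u i (i + 1 + j) := by
    refine Finset.sum_congr rfl fun i hi => Finset.sum_congr rfl fun j hj => ?_
    rw [← h3 i (i + 1 + j) (by omega) (by have := Finset.mem_range.1 hj; omega)]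
    congr 2
    omega
  rw [hA, hC]
  simp

/-- Cochains on the singular simplices `σ` of `E` that carry a label, an arbitrary map `β` from the
simplex to a set `T`. When `T` is the universal cover of a space `B` below `E`, the labels that are
lifts of the image of `σ` in `B` make these the cochains of the pull-back of `T` to `E`. No
condition is imposed on the labels here, so that all formulas hold without transports. -/
abbrev LabelledCochains (E T V : Type*) [TopologicalSpace E] (n : ℕ) : Type _ :=
  C(Simplex n, E) → (Simplex n → T) → V

variable {k : Type*} [Field k] {E T V : Type*} [TopologicalSpace E] [AddCommGroup V] [Module k V]

variable (k) in
/-- The differential of labelled cochains. -/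
def labelledDifferential {n : ℕ} (c : LabelledCochains E T V n) : LabelledCochains E T V (n + 1) :=
  fun σ β => ∑ j : Fin (n + 2), (-1 : k) ^ (j : ℕ) • c (σ.comp (face j)) (β ∘ face j)

/-- The affine map `Δᵐ → Δⁿ × [0, 1]` that sends the `a`-th vertex to the `g a`-th vertex, at the
height `ε a`. -/
def prismMap {m n : ℕ} (g : Fin (m + 1) → Fin (n + 1)) (ε : Fin (m + 1) → Fin 2) :
    C(Simplex m, Simplex n × unitInterval) :=
  ⟨fun x => (stdSimplex.map g x, ⟨stdSimplex.map ε x 1, stdSimplex.zero_le _ _,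
    stdSimplex.le_one _ _⟩),
    (stdSimplex.continuous_map g).prodMk (((continuous_apply 1).comp
      (continuous_subtype_val.comp (stdSimplex.continuous_map ε))).subtype_mk _)⟩

theorem prismMap_comp_face {m n : ℕ} (g : Fin (m + 2) → Fin (n + 1)) (ε : Fin (m + 2) → Fin 2)
    (j : Fin (m + 2)) :
    (prismMap g ε).comp (face j) = prismMap (g ∘ j.succAbove) (ε ∘ j.succAbove) := by
  refine ContinuousMap.ext fun x => Prod.ext ?_ (Subtype.ext ?_)
  · exact stdSimplex.map_comp_apply _ _ _
  · exact DFunLike.congr_fun (stdSimplex.map_comp_apply j.succAbove ε x) 1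

theorem face_prodMap_comp_prismMap {m n : ℕ} (g : Fin (m + 1) → Fin (n + 1))
    (ε : Fin (m + 1) → Fin 2) (j : Fin (n + 2)) :
    ((face j).prodMap (ContinuousMap.id unitInterval)).comp (prismMap g ε) =
      prismMap (j.succAbove ∘ g) ε :=
  ContinuousMap.ext fun _ => Prod.ext (stdSimplex.map_comp_apply _ _ _) rfl

theorem prismMap_id_zero (n : ℕ) (x : Simplex n) :
    prismMap (n := n) id (fun _ => 0) x = (x, 0) := by
  refine Prod.ext (stdSimplex.map_id_apply x) (Subtype.ext ?_)
  change FunOnFinite.linearMap ℝ ℝ (fun _ => (0 : Fin 2)) x 1 = 0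
  simp [FunOnFinite.linearMap_apply_apply]

theorem prismMap_id_one (n : ℕ) (x : Simplex n) :
    prismMap (n := n) id (fun _ => 1) x = (x, 1) := by
  refine Prod.ext (stdSimplex.map_id_apply x) (Subtype.ext ?_)
  change FunOnFinite.linearMap ℝ ℝ (fun _ => (1 : Fin 2)) x 1 = 1
  simp only [FunOnFinite.linearMap_apply_apply, Finset.filter_true]
  exact stdSimplex.sum_eq_one x

/-- The vertices of the `i`-th simplex in the triangulation of the prism over an `n`-simplex,
projected to the base: the `i`-th vertex is repeated. -/
def prismVertex (n i : ℕ) (a : Fin (n + 2)) : Fin (n + 1) :=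
  Fin.ofNat (n + 1) (if (a : ℕ) ≤ i then a else a - 1)

/-- The heights of the vertices of the `i`-th simplex in the triangulation of a prism. -/
def prismHeight (n i : ℕ) (a : Fin (n + 2)) : Fin 2 := if (a : ℕ) ≤ i then 0 else 1

variable (k) in
/-- The prism operator. It is evaluated at a homotopy `K` of singular `n`-simplices of `E`. -/
def prism {n : ℕ} (c : LabelledCochains E T V (n + 1)) (K : C(Simplex n × unitInterval, E))
    (β : Simplex n → T) : V :=
  ∑ i ∈ Finset.range (n + 1), (-1 : k) ^ i •
    c (K.comp (prismMap (prismVertex n i) (prismHeight n i)))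
      (β ∘ stdSimplex.map (prismVertex n i))

/-- The map of vertices that skips `j`, with `j` a natural number. -/
def skip (n j : ℕ) (a : Fin (n + 1)) : Fin (n + 2) :=
  Fin.ofNat (n + 2) (if (a : ℕ) < j then a else a + 1)

theorem skip_val {n : ℕ} (j : ℕ) (a : Fin (n + 1)) :
    (skip n j a : ℕ) = if (a : ℕ) < j then (a : ℕ) else a + 1 := by
  simp only [skip, Fin.ofNat]
  exact Nat.mod_eq_of_lt (by split_ifs <;> omega)

theorem succAbove_eq_skip {n : ℕ} (j : Fin (n + 2)) : j.succAbove = skip n j := by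
  ext a
  rw [skip_val, Fin.succAbove]
  simp only [Fin.lt_def, Fin.val_castSucc]
  split_ifs <;> simp

theorem prismVertex_val {n i : ℕ} (hi : i ≤ n) (a : Fin (n + 2)) :
    (prismVertex n i a : ℕ) = if (a : ℕ) ≤ i then (a : ℕ) else a - 1 := by
  simp only [prismVertex, Fin.ofNat]
  exact Nat.mod_eq_of_lt (by split_ifs <;> omega)

/-- The value of a cochain on the simplex of a prism with given vertices. -/
def prismValue {m n : ℕ} (c : LabelledCochains E T V m) (K : C(Simplex n × unitInterval, E))
    (β : Simplex n → T) (g : Fin (m + 1) → Fin (n + 1)) (ε : Fin (m + 1) → Fin 2) : V :=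
  c (K.comp (prismMap g ε)) (β ∘ stdSimplex.map g)

theorem prism_labelledDifferential {n : ℕ} (c : LabelledCochains E T V n)
    (K : C(Simplex n × unitInterval, E)) (β : Simplex n → T) :
    prism k (labelledDifferential k c) K β =
      ∑ i ∈ Finset.range (n + 1), (-1 : k) ^ i • ∑ j ∈ Finset.range (n + 2), (-1 : k) ^ j •
        prismValue c K β (prismVertex n i ∘ skip n j) (prismHeight n i ∘ skip n j) := by
  refine Finset.sum_congr rfl fun i _ => congrArg _ ?_
  rw [← Fin.sum_univ_eq_sum_range (fun j => (-1 : k) ^ j •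
    prismValue c K β (prismVertex n i ∘ skip n j) (prismHeight n i ∘ skip n j))]
  refine Finset.sum_congr rfl fun j _ => congrArg _ ?_
  rw [ContinuousMap.comp_assoc, prismMap_comp_face, ← succAbove_eq_skip]
  refine congrArg (c _) (funext fun x => congrArg β ?_)
  exact stdSimplex.map_comp_apply _ _ _

theorem prismValue_top {W : Type*} {n : ℕ} (c : LabelledCochains E T W n)
    (K : C(Simplex n × unitInterval, E)) (β : Simplex n → T) :
    prismValue c K β (prismVertex n 0 ∘ skip n 0) (prismHeight n 0 ∘ skip n 0) =
      c (K.comp ⟨fun x => (x, 1), by fun_prop⟩) β := by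
  have h1 : prismVertex n 0 ∘ skip n 0 = id := by
    ext a
    simp [prismVertex_val, skip_val]
  have h2 : prismHeight n 0 ∘ skip n 0 = fun _ => 1 := by
    ext a
    simp [prismHeight, skip_val]
  rw [h1, h2, prismValue]
  congr 1
  · exact congrArg K.comp (ContinuousMap.ext fun x => prismMap_id_one n x)
  · exact funext fun x => congrArg β (stdSimplex.map_id_apply x)

theorem prismValue_bottom {W : Type*} {n : ℕ} (c : LabelledCochains E T W n)
    (K : C(Simplex n × unitInterval, E)) (β : Simplex n → T) :
    prismValue c K β (prismVertex n n ∘ skip n (n + 1)) (prismHeight n n ∘ skip n (n + 1)) =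
      c (K.comp ⟨fun x => (x, 0), by fun_prop⟩) β := by
  have h1 : prismVertex n n ∘ skip n (n + 1) = id := by
    ext a
    simp [prismVertex_val, skip_val, Nat.le_of_lt_succ a.2]
  have h2 : prismHeight n n ∘ skip n (n + 1) = fun _ => 0 := by
    ext a
    simp [prismHeight, skip_val, Nat.le_of_lt_succ a.2]
  rw [h1, h2, prismValue]
  congr 1
  · exact congrArg K.comp (ContinuousMap.ext fun x => prismMap_id_zero n x)
  · exact funext fun x => congrArg β (stdSimplex.map_id_apply x)

theorem prism_homotopy_zero (c : LabelledCochains E T V 0) (K : C(Simplex 0 × unitInterval, E))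
    (β : Simplex 0 → T) :
    prism k (labelledDifferential k c) K β = c (K.comp ⟨fun x => (x, 1), by fun_prop⟩) β -
      c (K.comp ⟨fun x => (x, 0), by fun_prop⟩) β := by
  rw [prism_labelledDifferential, ← prismValue_top c K β, ← prismValue_bottom c K β]
  simp [Finset.sum_range_succ, sub_eq_add_neg]

/-- The prism operator is a cochain homotopy between the evaluations on the two ends. -/
theorem prism_homotopy_succ {n : ℕ} (c : LabelledCochains E T V (n + 1))
    (K : C(Simplex (n + 1) × unitInterval, E)) (β : Simplex (n + 1) → T) :
    prism k (labelledDifferential k c) K β + ∑ j : Fin (n + 2), (-1 : k) ^ (j : ℕ) •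
        prism k c (K.comp ((face j).prodMap (ContinuousMap.id unitInterval))) (β ∘ face j) =
      c (K.comp ⟨fun x => (x, 1), by fun_prop⟩) β -
        c (K.comp ⟨fun x => (x, 0), by fun_prop⟩) β := by
  have hU : ∑ j : Fin (n + 2), (-1 : k) ^ (j : ℕ) •
        prism k c (K.comp ((face j).prodMap (ContinuousMap.id unitInterval))) (β ∘ face j) =
      ∑ j ∈ Finset.range (n + 2), (-1 : k) ^ j • ∑ i ∈ Finset.range (n + 1), (-1 : k) ^ i •
        prismValue c K β (skip n j ∘ prismVertex n i) (prismHeight n i) := by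
    rw [← Fin.sum_univ_eq_sum_range (fun j => (-1 : k) ^ j • ∑ i ∈ Finset.range (n + 1),
      (-1 : k) ^ i • prismValue c K β (skip n j ∘ prismVertex n i) (prismHeight n i))]
    refine Finset.sum_congr rfl fun j _ => congrArg _ (Finset.sum_congr rfl fun i _ =>
      congrArg _ ?_)
    rw [ContinuousMap.comp_assoc, face_prodMap_comp_prismMap, ← succAbove_eq_skip]
    refine congrArg (c _) (funext fun x => congrArg β ?_)
    exact stdSimplex.map_comp_apply _ _ _
  rw [prism_labelledDifferential, hU, ← prismValue_top c K β, ← prismValue_bottom c K β]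
  refine sum_prism_faces (n + 1)
    (fun i j => prismValue c K β (prismVertex (n + 1) i ∘ skip (n + 1) j)
      (prismHeight (n + 1) i ∘ skip (n + 1) j))
    (fun i j => prismValue c K β (skip n j ∘ prismVertex n i) (prismHeight n i)) ?_ ?_ ?_
  · intro i j hi hj
    congr 1
    · ext a
      simp only [Function.comp_apply, prismVertex_val (show i + 1 ≤ n + 1 by omega), skip_val,
        prismVertex_val (show i ≤ n by omega)]
      split_ifs <;> omega
    · ext a
      simp only [Function.comp_apply, prismHeight, skip_val]
      split_ifs <;> first | rfl | omega
  · intro i hi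
    congr 1
    · ext a
      simp only [Function.comp_apply, prismVertex_val (show i + 1 ≤ n + 1 by omega), skip_val,
        prismVertex_val (show i ≤ n + 1 by omega)]
      split_ifs <;> omega
    · ext a
      simp only [Function.comp_apply, prismHeight, skip_val]
      split_ifs <;> first | rfl | omega
  · intro i j hij hj
    congr 1
    · ext a
      simp only [Function.comp_apply, prismVertex_val (show i ≤ n + 1 by omega), skip_val,
        prismVertex_val (show i ≤ n by omega)]
      split_ifs <;> omega
    · ext a
      simp only [Function.comp_apply, prismHeight, skip_val]
      split_ifs <;> first | rfl | omega

end LabelledCochains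

/-! ### Twisted cochains and lifts of simplices -/

section Pullback

variable {X Y : Type*} [TopologicalSpace X] [TopologicalSpace Y]

theorem quotient_map_trans (f : C(X, Y)) {a b c : X} (γ : Path.Homotopic.Quotient a b)
    (δ : Path.Homotopic.Quotient b c) : (γ.trans δ).map f = (γ.map f).trans (δ.map f) := by
  induction γ using Path.Homotopic.Quotient.ind with | _ γ
  induction δ using Path.Homotopic.Quotient.ind with | _ δ
  exact congrArg Path.Homotopic.Quotient.mk (Path.map_trans γ δ f.continuous)

theorem quotient_map_symm (f : C(X, Y)) {a b : X} (γ : Path.Homotopic.Quotient a b) :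
    γ.symm.map f = (γ.map f).symm := by
  induction γ using Path.Homotopic.Quotient.ind with | _ γ
  rfl

theorem toPath_map (f : C(X, Y)) (x : X) (g : FundamentalGroup X x) :
    FundamentalGroup.toPath (FundamentalGroup.map f x g) = (FundamentalGroup.toPath g).map f :=
  rfl

variable {k : Type*} [Field k] {V : Type*} [AddCommGroup V] [Module k V]

/-- The map on twisted cochains induced by a continuous map. The representation on the source is a
variable `τ'`, known to be the pull-back of `τ`. -/
def cochainPullback (f : C(X, Y)) (x : X)
    (τ : FundamentalGroup Y (f x) →* LinearMap.GeneralLinearGroup k V)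
    (τ' : FundamentalGroup X x →* LinearMap.GeneralLinearGroup k V)
    (h : ∀ g, τ' g = τ (FundamentalGroup.map f x g)) (n : ℕ) :
    TwistedCochains (f x) τ n →ₗ[k] TwistedCochains x τ' n where
  toFun c := ⟨fun σ γ => c.1 (f.comp σ) (γ.map f), fun σ γ g => by
    change c.1 (f.comp σ) (Path.Homotopic.Quotient.map _ f) = _
    rw [h, quotient_map_trans, ← toPath_map, map_inv]
    exact c.2 (f.comp σ) (γ.map f) (FundamentalGroup.map f x g)⟩
  map_add' _ _ := rfl
  map_smul' _ _ := rfl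

variable {f : C(X, Y)} {x : X} {τ : FundamentalGroup Y (f x) →* LinearMap.GeneralLinearGroup k V}
  {τ' : FundamentalGroup X x →* LinearMap.GeneralLinearGroup k V}

theorem twistedDifferential_apply {x : X}
    (τ : FundamentalGroup X x →* LinearMap.GeneralLinearGroup k V) {n : ℕ}
    (c : TwistedCochains x τ n) (σ : C(Simplex (n + 1), X))
    (γ : Path.Homotopic.Quotient x (σ (v₀ (n + 1)))) :
    (twistedDifferential x τ n c).1 σ γ = ∑ j : Fin (n + 2), (-1 : k) ^ (j : ℕ) •
      c.1 (σ.comp (face j)) (γ.trans ((simplexPath (v₀ (n + 1)) (face j (v₀ n))).map σ)) := by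
  have h : (twistedDifferential x τ n c).1 =
      ∑ j : Fin (n + 2), (-1 : k) ^ (j : ℕ) • (coface x τ j c).1 := by
    rw [twistedDifferential, LinearMap.sum_apply]
    exact map_sum (equivariantCochains x τ (n + 1)).subtype _ _
  rw [h, Finset.sum_apply, Finset.sum_apply]
  rfl

theorem cochainPullback_differential (h : ∀ g, τ' g = τ (FundamentalGroup.map f x g)) {n : ℕ}
    (c : TwistedCochains (f x) τ n) :
    cochainPullback f x τ τ' h (n + 1) (twistedDifferential (f x) τ n c) =
      twistedDifferential x τ' n (cochainPullback f x τ τ' h n c) := by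
  refine Subtype.ext (funext fun σ => funext fun γ => ?_)
  rw [twistedDifferential_apply]
  refine (twistedDifferential_apply τ c (f.comp σ) (γ.map f)).trans ?_
  refine Finset.sum_congr rfl fun j _ => congrArg _ ?_
  change _ = c.1 (f.comp (σ.comp (face j))) (Path.Homotopic.Quotient.map _ f)
  rw [quotient_map_trans, ← Path.Homotopic.Quotient.map_comp]
  rfl

theorem twistedDifferential_cochainPullback_eq_zero
    (h : ∀ g, τ' g = τ (FundamentalGroup.map f x g)) {n : ℕ} {c : TwistedCochains (f x) τ n}
    (hc : twistedDifferential (f x) τ n c = 0) :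
    twistedDifferential x τ' n (cochainPullback f x τ τ' h n c) = 0 := by
  rw [← cochainPullback_differential, hc, map_zero]

theorem cochainPullback_mem_coboundaries (h : ∀ g, τ' g = τ (FundamentalGroup.map f x g)) {n : ℕ}
    {c : TwistedCochains (f x) τ n} (hc : c ∈ twistedCoboundaries (f x) τ n) :
    cochainPullback f x τ τ' h n c ∈ twistedCoboundaries x τ' n := by
  cases n with
  | zero =>
    rw [(Submodule.mem_bot k).1 hc]
    exact (Submodule.mem_bot k).2 (map_zero _)
  | succ n =>
    obtain ⟨b, rfl⟩ := hc
    exact ⟨_, (cochainPullback_differential h b).symm⟩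

end Pullback

section Labels

variable {B : Type*} [TopologicalSpace B] {b₀ : B}

/-- The underlying set of the universal cover of `B`: the points of `B` with a homotopy class of
paths from the base point. -/
abbrev Label (b₀ : B) : Type _ := Σ y : B, Path.Homotopic.Quotient b₀ y

/-- The lift of a simplex of `B` to the universal cover with a given initial vertex. -/
def label {n : ℕ} (σ : C(Simplex n, B)) (γ : Path.Homotopic.Quotient b₀ (σ (v₀ n))) :
    Simplex n → Label b₀ :=
  fun a => ⟨σ a, γ.trans ((simplexPath (v₀ n) a).map σ)⟩

theorem label_initial {n : ℕ} (σ : C(Simplex n, B)) (γ : Path.Homotopic.Quotient b₀ (σ (v₀ n))) :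
    label σ γ (v₀ n) = ⟨σ (v₀ n), γ⟩ := by
  have h : (simplexPath (v₀ n) (v₀ n)).map σ = Path.Homotopic.Quotient.refl (σ (v₀ n)) := by
    rw [simplexPath_unique (simplexPath (v₀ n) (v₀ n)) (Path.Homotopic.Quotient.refl _)]
    rfl
  simp only [label, h, Path.Homotopic.Quotient.trans_refl]

theorem label_comp {m n : ℕ} (σ : C(Simplex n, B)) (γ : Path.Homotopic.Quotient b₀ (σ (v₀ n)))
    (φ : C(Simplex m, Simplex n)) :
    label σ γ ∘ φ =
      label (σ.comp φ) (γ.trans ((simplexPath (v₀ n) (φ (v₀ m))).map σ)) := by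
  funext a
  refine Sigma.ext rfl (heq_of_eq ?_)
  change γ.trans ((simplexPath (v₀ n) (φ a)).map σ) =
    (γ.trans ((simplexPath (v₀ n) (φ (v₀ m))).map σ)).trans ((simplexPath (v₀ m) a).map (σ.comp φ))
  rw [Path.Homotopic.Quotient.trans_assoc, Path.Homotopic.Quotient.map_comp, ← quotient_map_trans,
    simplexPath_unique (simplexPath (v₀ n) (φ a))]

/-- The action of the fundamental group on labels by deck transformations. -/
def smulLabel {S : Type*} (g : FundamentalGroup B b₀) (β : S → Label b₀) : S → Label b₀ :=
  fun a => ⟨(β a).1, (FundamentalGroup.toPath g⁻¹).trans (β a).2⟩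

theorem label_smul {n : ℕ} (σ : C(Simplex n, B)) (γ : Path.Homotopic.Quotient b₀ (σ (v₀ n)))
    (g : FundamentalGroup B b₀) :
    label σ ((FundamentalGroup.toPath g⁻¹).trans γ) = smulLabel g (label σ γ) := by
  funext a
  exact Sigma.ext rfl (heq_of_eq (Path.Homotopic.Quotient.trans_assoc _ _ _))

end Labels

section CochainsOfLifts

variable {B E : Type*} [TopologicalSpace B] [TopologicalSpace E] {p : C(E, B)} {e₀ : E}
  {k : Type*} [Field k] {V : Type*} [AddCommGroup V] [Module k V]
  {τ : FundamentalGroup B (p e₀) →* LinearMap.GeneralLinearGroup k V}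
  {τ' : FundamentalGroup E e₀ →* LinearMap.GeneralLinearGroup k V}

/-- Two classes of paths with the same image in `B` differ by an element of the kernel of the map on
fundamental groups, which acts trivially through `τ'`. -/
theorem cochain_eq_of_map_eq (hτ : ∀ g, τ' g = τ (FundamentalGroup.map p e₀ g)) {n : ℕ}
    (c : TwistedCochains e₀ τ' n) (σ : C(Simplex n, E))
    {γ γ' : Path.Homotopic.Quotient e₀ (σ (v₀ n))} (h : γ.map p = γ'.map p) :
    c.1 σ γ = c.1 σ γ' := by
  let g : FundamentalGroup E e₀ := FundamentalGroup.fromPath (γ.trans γ'.symm)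
  have hg : (FundamentalGroup.toPath (g⁻¹)⁻¹).trans γ' = γ := by
    rw [inv_inv]
    change (γ.trans γ'.symm).trans γ' = γ
    rw [Path.Homotopic.Quotient.trans_assoc, Path.Homotopic.Quotient.symm_trans,
      Path.Homotopic.Quotient.trans_refl]
  have hp : FundamentalGroup.map p e₀ g = 1 := by
    change (γ.trans γ'.symm).map p = Path.Homotopic.Quotient.refl _
    rw [quotient_map_trans, quotient_map_symm, h, Path.Homotopic.Quotient.trans_symm]
  have := c.2 σ γ' g⁻¹
  rw [hg, hτ, map_inv, hp, inv_one, map_one] at this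
  exact this

/-- A twisted cochain of `E` as a function of simplices of `E` with a label in the universal cover
of `B`. The value only involves the label of the initial vertex; it is zero if the latter is not
the image of a class of paths in `E`. -/
def labelledOf (p : C(E, B)) {n : ℕ} (c : TwistedCochains e₀ τ' n) :
    LabelledCochains E (Label (p e₀)) V n := fun σ β =>
  open Classical in
  if h : ∃ γ : Path.Homotopic.Quotient e₀ (σ (v₀ n)), β (v₀ n) = ⟨p (σ (v₀ n)), γ.map p⟩ then
    c.1 σ h.choose
  else 0

theorem labelledOf_eq (hτ : ∀ g, τ' g = τ (FundamentalGroup.map p e₀ g)) {n : ℕ}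
    (c : TwistedCochains e₀ τ' n) {σ : C(Simplex n, E)} {β : Simplex n → Label (p e₀)}
    {γ : Path.Homotopic.Quotient e₀ (σ (v₀ n))} (h : β (v₀ n) = ⟨p (σ (v₀ n)), γ.map p⟩) :
    labelledOf p c σ β = c.1 σ γ := by
  have h' : ∃ γ : Path.Homotopic.Quotient e₀ (σ (v₀ n)),
      β (v₀ n) = ⟨p (σ (v₀ n)), γ.map p⟩ := ⟨γ, h⟩
  refine (dif_pos h').trans (cochain_eq_of_map_eq hτ c σ ?_)
  exact eq_of_heq (Sigma.mk.inj (h'.choose_spec.symm.trans h)).2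

theorem labelledOf_label (hτ : ∀ g, τ' g = τ (FundamentalGroup.map p e₀ g)) {n : ℕ}
    (c : TwistedCochains e₀ τ' n) (σ : C(Simplex n, E))
    (γ : Path.Homotopic.Quotient e₀ (σ (v₀ n))) :
    labelledOf p c σ (label (p.comp σ) (γ.map p)) = c.1 σ γ :=
  labelledOf_eq hτ c (label_initial _ _)

theorem labelledDifferential_label (hτ : ∀ g, τ' g = τ (FundamentalGroup.map p e₀ g)) {n : ℕ}
    (c : TwistedCochains e₀ τ' n) (σ : C(Simplex (n + 1), E))
    (γ : Path.Homotopic.Quotient e₀ (σ (v₀ (n + 1)))) :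
    labelledDifferential k (labelledOf p c) σ (label (p.comp σ) (γ.map p)) =
      (twistedDifferential e₀ τ' n c).1 σ γ := by
  rw [twistedDifferential_apply, labelledDifferential]
  refine Finset.sum_congr rfl fun j _ => congrArg _ (labelledOf_eq hτ c ?_)
  rw [label_comp, label_initial, quotient_map_trans, ← Path.Homotopic.Quotient.map_comp]
  rfl

/-- Homotopy classes of paths in `B` between images of points of `E` lift to `E`. -/
def LiftsPaths (p : C(E, B)) : Prop :=
  ∀ e e' : E, Function.Surjective
    (fun γ : Path.Homotopic.Quotient e e' => Path.Homotopic.Quotient.map γ p)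

theorem LiftsPaths.exists_label_eq (hp : LiftsPaths p) (e : E) {z : Label (p e₀)}
    (hz : z.1 = p e) : ∃ γ : Path.Homotopic.Quotient e₀ e, z = ⟨p e, γ.map p⟩ := by
  obtain ⟨y, δ⟩ := z
  obtain rfl : y = p e := hz
  obtain ⟨γ, rfl⟩ := hp e₀ e δ
  exact ⟨γ, rfl⟩

theorem LiftsPaths.exists_lift (hp : LiftsPaths p) {n : ℕ} {σ : C(Simplex n, B)}
    {w : C(Simplex n, E)} (hw : p.comp w = σ) (γ : Path.Homotopic.Quotient (p e₀) (σ (v₀ n))) :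
    ∃ δ : Path.Homotopic.Quotient e₀ (w (v₀ n)), label σ γ = label (p.comp w) (δ.map p) ∧
      ∀ c : TwistedCochains (p e₀) τ n, c.1 σ γ = c.1 (p.comp w) (δ.map p) := by
  subst hw
  obtain ⟨δ, rfl⟩ := hp e₀ (w (v₀ n)) γ
  exact ⟨δ, rfl, fun _ => rfl⟩

theorem labelledOf_smul (hτ : ∀ g, τ' g = τ (FundamentalGroup.map p e₀ g)) (hp : LiftsPaths p)
    {n : ℕ} (c : TwistedCochains e₀ τ' n) {σ : C(Simplex n, E)} {β : Simplex n → Label (p e₀)}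
    (h : (β (v₀ n)).1 = p (σ (v₀ n))) (g : FundamentalGroup B (p e₀)) :
    labelledOf p c σ (smulLabel g β) = (τ g).1 (labelledOf p c σ β) := by
  obtain ⟨γ, hγ⟩ := hp.exists_label_eq _ h
  obtain ⟨δ, hδ⟩ := hp e₀ e₀ (FundamentalGroup.toPath g)
  let G : FundamentalGroup E e₀ := FundamentalGroup.fromPath δ
  have hG : FundamentalGroup.map p e₀ G = g := hδ
  have h' : smulLabel g β (v₀ n) =
      ⟨p (σ (v₀ n)), ((FundamentalGroup.toPath G⁻¹).trans γ).map p⟩ := by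
    rw [quotient_map_trans, ← toPath_map, map_inv, hG, smulLabel, hγ]
  rw [labelledOf_eq hτ c hγ, labelledOf_eq hτ c h', c.2, hτ, hG]

/-- The cochain of `B` that takes on a simplex the value of `c` on its chosen lift. -/
def sectionPullback (hτ : ∀ g, τ' g = τ (FundamentalGroup.map p e₀ g)) (hp : LiftsPaths p) {n : ℕ}
    (s : C(Simplex n, B) → C(Simplex n, E)) (hs : ∀ σ, p.comp (s σ) = σ)
    (c : TwistedCochains e₀ τ' n) : TwistedCochains (p e₀) τ n :=
  ⟨fun σ γ => labelledOf p c (s σ) (label σ γ), fun σ γ g => by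
    change labelledOf p c (s σ) (label σ _) = _
    rw [label_smul, labelledOf_smul hτ hp]
    exact (DFunLike.congr_fun (hs σ) (v₀ n)).symm⟩

theorem sectionPullback_cochainPullback (hτ : ∀ g, τ' g = τ (FundamentalGroup.map p e₀ g))
    (hp : LiftsPaths p) {n : ℕ} (s : C(Simplex n, B) → C(Simplex n, E))
    (hs : ∀ σ, p.comp (s σ) = σ) (c : TwistedCochains (p e₀) τ n) :
    sectionPullback hτ hp s hs (cochainPullback p e₀ τ τ' hτ n c) = c := by
  refine Subtype.ext (funext fun σ => funext fun γ => ?_)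
  obtain ⟨δ, hδ, hc⟩ := hp.exists_lift (τ := τ) (hs σ) γ
  change labelledOf p _ (s σ) (label σ γ) = _
  rw [hδ, labelledOf_label hτ, hc]
  rfl

/-- Compatibility with faces of the lifts makes the evaluation on them a cochain map. -/
theorem sectionPullback_differential (hτ : ∀ g, τ' g = τ (FundamentalGroup.map p e₀ g))
    (hp : LiftsPaths p) {n : ℕ} (s : C(Simplex n, B) → C(Simplex n, E))
    (hs : ∀ σ, p.comp (s σ) = σ) (s' : C(Simplex (n + 1), B) → C(Simplex (n + 1), E))
    (hs' : ∀ σ, p.comp (s' σ) = σ) (hss : ∀ σ i, (s' σ).comp (face i) = s (σ.comp (face i)))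
    (c : TwistedCochains e₀ τ' n) :
    sectionPullback hτ hp s' hs' (twistedDifferential e₀ τ' n c) =
      twistedDifferential (p e₀) τ n (sectionPullback hτ hp s hs c) := by
  refine Subtype.ext (funext fun σ => funext fun γ => ?_)
  obtain ⟨δ, hδ, -⟩ := hp.exists_lift (τ := τ) (hs' σ) γ
  change labelledOf p _ (s' σ) (label σ γ) = _
  rw [hδ, labelledOf_label hτ, ← labelledDifferential_label hτ, ← hδ, twistedDifferential_apply]
  refine Finset.sum_congr rfl fun j _ => congrArg _ ?_
  change _ = labelledOf p c (s (σ.comp (face j))) (label (σ.comp (face j)) _)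
  rw [hss, label_comp]

end CochainsOfLifts

/-! ### Cohomology of maps with the lifting property -/

section CohomologyOfLifts

variable {B E : Type*} [TopologicalSpace B] [TopologicalSpace E] {p : C(E, B)} {e₀ : E}
  {k : Type*} [Field k] {V : Type*} [AddCommGroup V] [Module k V]
  {τ : FundamentalGroup B (p e₀) →* LinearMap.GeneralLinearGroup k V}
  {τ' : FundamentalGroup E e₀ →* LinearMap.GeneralLinearGroup k V}

theorem liftsPaths_of_hasLift (h : HasLift p (Cube.boundary (Fin 1))) : LiftsPaths p := by
  intro e e' γ
  induction γ using Path.Homotopic.Quotient.ind with | _ γ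
  obtain ⟨δ, rfl⟩ := exists_path_lift h e e' γ
  exact ⟨.mk δ, rfl⟩

/-- The cochain obtained by evaluating `c` on the prisms of fibrewise homotopies `K`. -/
def prismPullback (hτ : ∀ g, τ' g = τ (FundamentalGroup.map p e₀ g)) (hp : LiftsPaths p) {n : ℕ}
    (K : C(Simplex n, E) → C(Simplex n × unitInterval, E)) (hK : ∀ σ x t, p (K σ (x, t)) = p (σ x))
    (c : TwistedCochains e₀ τ' (n + 1)) : TwistedCochains e₀ τ' n :=
  ⟨fun σ γ => prism k (labelledOf p c) (K σ) (label (p.comp σ) (γ.map p)), fun σ γ g => by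
    change prism k _ (K σ) (label (p.comp σ) (Path.Homotopic.Quotient.map _ p)) = _
    rw [quotient_map_trans, ← toPath_map, map_inv]
    refine (congrArg (prism k _ (K σ)) (label_smul (p.comp σ) _ _)).trans ?_
    rw [prism, hτ]
    refine Eq.trans ?_ (map_sum (τ (FundamentalGroup.map p e₀ g)).1 _ _).symm
    refine Finset.sum_congr rfl fun i _ => ?_
    rw [map_smul]
    exact congrArg _ (labelledOf_smul hτ hp c (hK σ _ _).symm (FundamentalGroup.map p e₀ g))⟩

/-- The differential of `labelledOf p c` vanishes on the simplices of a prism over a simplex, since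
their labels come from classes of paths in `E`. -/
theorem prism_labelledDifferential_eq_zero (hτ : ∀ g, τ' g = τ (FundamentalGroup.map p e₀ g))
    (hp : LiftsPaths p) {n : ℕ} (c : TwistedCochains e₀ τ' n)
    (hc : twistedDifferential e₀ τ' n c = 0) (σ : C(Simplex n, E))
    (K : C(Simplex n × unitInterval, E)) (hK : ∀ x t, p (K (x, t)) = p (σ x))
    (γ : Path.Homotopic.Quotient (p e₀) (p (σ (v₀ n)))) :
    prism k (labelledDifferential k (labelledOf p c)) K (label (p.comp σ) γ) = 0 := by
  refine Finset.sum_eq_zero fun i _ => ?_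
  let φ : C(Simplex (n + 1), Simplex n) :=
    ⟨stdSimplex.map (prismVertex n i), stdSimplex.continuous_map _⟩
  have hβ := label_comp (p.comp σ) γ φ
  obtain ⟨δ, hδ, -⟩ := hp.exists_lift (τ := τ) (σ := (p.comp σ).comp φ)
    (w := K.comp (prismMap (prismVertex n i) (prismHeight n i)))
    (ContinuousMap.ext fun x => hK _ _)
    (γ.trans ((simplexPath (v₀ n) (φ (v₀ (n + 1)))).map (p.comp σ)))
  rw [show label (p.comp σ) γ ∘ stdSimplex.map (prismVertex n i) = _ from hβ.trans hδ,
    labelledDifferential_label hτ, hc]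
  exact smul_zero _

variable {q : ℕ}

/-- A map with the lifting property for cells up to dimension `q` induces injections in cohomology
up to degree `q`: the pull-back along a system of lifts of simplices is a retraction. -/
theorem mem_coboundaries_of_cochainPullback (hτ : ∀ g, τ' g = τ (FundamentalGroup.map p e₀ g))
    (h : ∀ n ≤ q, HasLift p (Cube.boundary (Fin n))) (hq : 1 ≤ q) {n : ℕ} (hn : n ≤ q)
    (c : TwistedCochains (p e₀) τ n)
    (hc : cochainPullback p e₀ τ τ' hτ n c ∈ twistedCoboundaries e₀ τ' n) :
    c ∈ twistedCoboundaries (p e₀) τ n := by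
  have hp := liftsPaths_of_hasLift (h 1 hq)
  have : Nonempty E := ⟨e₀⟩
  obtain ⟨s, hs, hs'⟩ := exists_section h
  rw [← sectionPullback_cochainPullback hτ hp (s n) (hs n hn) c]
  cases n with
  | zero =>
    rw [(Submodule.mem_bot k).1 hc]
    refine (Submodule.mem_bot k).2 (Subtype.ext (funext fun σ => funext fun γ => ?_))
    obtain ⟨δ, hδ, -⟩ := hp.exists_lift (τ := τ) (hs 0 hn σ) γ
    change labelledOf p _ (s 0 σ) (label σ γ) = 0
    rw [hδ, labelledOf_label hτ]
    rfl
  | succ n =>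
    obtain ⟨b, hb⟩ := hc
    rw [← hb, sectionPullback_differential hτ hp (s n) (hs n (by omega)) (s (n + 1)) (hs _ hn)
      (hs' n hn)]
    exact ⟨_, rfl⟩

/-- A map with the lifting property for cells up to dimension `q` induces surjections in cohomology
below degree `q`: lifting and projecting a simplex is fibrewise homotopic to the identity. -/
theorem exists_cochainPullback_sub_mem_coboundaries
    (hτ : ∀ g, τ' g = τ (FundamentalGroup.map p e₀ g))
    (h : ∀ n ≤ q, HasLift p (Cube.boundary (Fin n))) {n : ℕ} (hn : n + 1 ≤ q)
    (c : TwistedCochains e₀ τ' n) (hc : twistedDifferential e₀ τ' n c = 0) :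
    ∃ c' : TwistedCochains (p e₀) τ n, twistedDifferential (p e₀) τ n c' = 0 ∧
      cochainPullback p e₀ τ τ' hτ n c' - c ∈ twistedCoboundaries e₀ τ' n := by
  have hp := liftsPaths_of_hasLift (h 1 (by omega))
  have : Nonempty E := ⟨e₀⟩
  obtain ⟨s, hs, hs'⟩ := exists_section h
  obtain ⟨K, hKp, hKe, hKf⟩ := exists_fibrewise_homotopies h
  refine ⟨sectionPullback hτ hp (s n) (hs n (by omega)) c, ?_, ?_⟩
  · rw [← sectionPullback_differential hτ hp (s n) _ (s (n + 1)) (hs _ hn) (hs' n hn), hc]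
    refine Subtype.ext (funext fun σ => funext fun γ => ?_)
    obtain ⟨δ, hδ, -⟩ := hp.exists_lift (τ := τ) (hs (n + 1) hn σ) γ
    change labelledOf p _ (s (n + 1) σ) (label σ γ) = 0
    rw [hδ, labelledOf_label hτ]
    rfl
  -- `L m σ` is the homotopy from `σ` to the chosen lift of its image.
  let pair : ∀ m, m ≤ q → C(Simplex m, E) → C(Simplex m, {z : E × E // p z.1 = p z.2}) :=
    fun m hm σ => ⟨fun x => ⟨(σ x, s m (p.comp σ) x),
      (DFunLike.congr_fun (hs m hm (p.comp σ)) x).symm⟩, by fun_prop⟩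
  let L : ∀ m, m ≤ q → C(Simplex m, E) → C(Simplex m × unitInterval, E) :=
    fun m hm σ => K m (pair m hm σ)
  have hLp : ∀ m (hm : m + 1 ≤ q) σ x t, p (L m (by omega) σ (x, t)) = p (σ x) :=
    fun m hm σ x t => hKp m hm _ x t
  have hL0 : ∀ m (hm : m + 1 ≤ q) σ,
      (L m (by omega) σ).comp ⟨fun x => (x, 0), by fun_prop⟩ = σ :=
    fun m hm σ => ContinuousMap.ext fun x => (hKe m hm _ x).1
  have hL1 : ∀ m (hm : m + 1 ≤ q) σ,
      (L m (by omega) σ).comp ⟨fun x => (x, 1), by fun_prop⟩ = s m (p.comp σ) :=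
    fun m hm σ => ContinuousMap.ext fun x => (hKe m hm _ x).2
  have hLf : ∀ m (hm : m + 2 ≤ q) σ i,
      (L (m + 1) (by omega) σ).comp ((face i).prodMap (ContinuousMap.id unitInterval)) =
        L m (by omega) (σ.comp (face i)) := by
    intro m hm σ i
    refine ContinuousMap.ext fun z => (hKf m hm _ i z.1 z.2).trans ?_
    refine DFunLike.congr_fun (congrArg (K m) ?_) z
    refine ContinuousMap.ext fun x => Subtype.ext (Prod.ext rfl ?_)
    exact DFunLike.congr_fun (hs' m (by omega) (p.comp σ) i) x
  have hval : ∀ (σ : C(Simplex n, E)) (γ : Path.Homotopic.Quotient e₀ (σ (v₀ n))),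
      (cochainPullback p e₀ τ τ' hτ n (sectionPullback hτ hp (s n) (hs n (by omega)) c) - c).1
        σ γ = labelledOf p c (s n (p.comp σ)) (label (p.comp σ) (γ.map p)) -
          labelledOf p c σ (label (p.comp σ) (γ.map p)) := fun σ γ => by
    rw [labelledOf_label hτ]
    rfl
  cases n with
  | zero =>
    refine (Submodule.mem_bot k).2 (Subtype.ext (funext fun σ => funext fun γ => ?_))
    have := prism_homotopy_zero (k := k) (labelledOf p c) (L 0 (by omega) σ)
      (label (p.comp σ) (γ.map p))
    rw [hL0 0 hn, hL1 0 hn,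
      prism_labelledDifferential_eq_zero hτ hp c hc σ _ (hLp 0 hn σ)] at this
    rw [hval, ← this]
    rfl
  | succ n =>
    refine ⟨prismPullback hτ hp (L n (by omega)) (hLp n (by omega)) c,
      Subtype.ext (funext fun σ => funext fun γ => ?_)⟩
    have := prism_homotopy_succ (k := k) (labelledOf p c) (L (n + 1) (by omega) σ)
      (label (p.comp σ) (γ.map p))
    rw [hL0 _ hn, hL1 _ hn,
      prism_labelledDifferential_eq_zero hτ hp c hc σ _ (hLp _ hn σ), zero_add] at this
    rw [hval, ← this, twistedDifferential_apply]
    refine Finset.sum_congr rfl fun j _ => congrArg _ ?_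
    change prism k (labelledOf p c) (L n (by omega) (σ.comp (face j)))
      (label (p.comp (σ.comp (face j))) (Path.Homotopic.Quotient.map _ p)) = _
    rw [hLf n hn, label_comp, quotient_map_trans, ← Path.Homotopic.Quotient.map_comp]
    rfl

end CohomologyOfLifts

section CohomologyMap

variable {X Y : Type*} [TopologicalSpace X] [TopologicalSpace Y] {f : C(X, Y)} {x : X}
  {k : Type*} [Field k] {V : Type*} [AddCommGroup V] [Module k V]

/-- The map induced in twisted cohomology by a continuous map. -/
def cohomologyMap (f : C(X, Y)) (x : X)
    (τ : FundamentalGroup Y (f x) →* LinearMap.GeneralLinearGroup k V) (n : ℕ) :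
    TwistedCohomology (f x) τ n →ₗ[k]
      TwistedCohomology x (τ.comp (FundamentalGroup.map f x)) n :=
  Submodule.mapQ _ _
    ((cochainPullback f x τ _ (fun _ => rfl) n).restrict fun c hc => by
      rw [LinearMap.mem_ker, ← cochainPullback_differential, LinearMap.mem_ker.1 hc, map_zero])
    fun c hc => cochainPullback_mem_coboundaries (fun _ => rfl) hc

/-- The fundamental groups see the mapping path space as homotopy equivalent to the source. -/
theorem map_endpoint_eq (f : C(X, Y)) (x : X)
    (g : FundamentalGroup (PathSpace f) (PathSpace.const f x)) :
    FundamentalGroup.map (PathSpace.endpoint f) (PathSpace.const f x) g =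
      FundamentalGroup.map f x
        (FundamentalGroup.map (PathSpace.source f) (PathSpace.const f x) g) := by
  let F : (f.comp (PathSpace.source f)).Homotopy (PathSpace.endpoint f) :=
    { toFun := fun z => z.2.1.2 z.1
      map_zero_left := fun z => z.2
      map_one_left := fun z => rfl }
  induction g using Path.Homotopic.Quotient.ind with | _ γ
  let a : Path (f x) (f x) := γ.map (PathSpace.endpoint f).continuous
  let b : Path (f x) (f x) := γ.map (f.comp (PathSpace.source f)).continuous
  -- The homotopy `F` is stationary at the base point.
  have key : (Path.Homotopic.Quotient.mk b).trans (.refl (f x)) =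
      (Path.Homotopic.Quotient.refl (f x)).trans (.mk a) :=
    Path.Homotopic.Quotient.eq.2 (Path.Homotopic.map_trans_evalAt F γ)
  rw [Path.Homotopic.Quotient.trans_refl, Path.Homotopic.Quotient.refl_trans] at key
  exact key.symm

end CohomologyMap

/-! ### Connected maps and jump loci -/

section QConnected

variable {X Y : Type*} [TopologicalSpace X] [TopologicalSpace Y] {f : C(X, Y)} {x : X}
  {k : Type*} [Field k] {V : Type*} [AddCommGroup V] [Module k V]

theorem hasLift_source_cube (f : C(X, Y)) (n : ℕ) :
    HasLift (PathSpace.source f) (Cube.boundary (Fin n)) :=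
  PathSpace.hasLift_source (isClosed_cubeBoundary n) (hasHEP_cubeBoundary n)

/-- The pull-backs of a representation of `π₁(Y)` to the mapping path space and to `X`, and the
comparison of the complex of `X` with that of the mapping path space: `const` induces an inverse,
in cohomology, to the isomorphism induced by `source`. -/
theorem exists_pathSpace_comparison
    (τ : FundamentalGroup Y (f x) →* LinearMap.GeneralLinearGroup k V) :
    ∃ (τP : FundamentalGroup (PathSpace f) (PathSpace.const f x) →*
        LinearMap.GeneralLinearGroup k V)
      (hp : ∀ g, τP g = τ (FundamentalGroup.map (PathSpace.endpoint f) (PathSpace.const f x) g))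
      (hr : ∀ g, τP g = (τ.comp (FundamentalGroup.map f x))
        (FundamentalGroup.map (PathSpace.source f) (PathSpace.const f x) g))
      (hj : ∀ g, (τ.comp (FundamentalGroup.map f x)) g =
        τP (FundamentalGroup.map (PathSpace.const f) x g)),
      (∀ n c, cochainPullback (PathSpace.const f) x τP (τ.comp (FundamentalGroup.map f x)) hj n
        (cochainPullback (PathSpace.source f) (PathSpace.const f x)
          (τ.comp (FundamentalGroup.map f x)) τP hr n c) = c) ∧
      ∀ n c, cochainPullback (PathSpace.const f) x τP (τ.comp (FundamentalGroup.map f x)) hj n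
        (cochainPullback (PathSpace.endpoint f) (PathSpace.const f x) τ τP hp n c) =
        cochainPullback f x τ (τ.comp (FundamentalGroup.map f x)) (fun _ => rfl) n c := by
  have hmap : ∀ g, FundamentalGroup.map (PathSpace.endpoint f) (PathSpace.const f x)
      (FundamentalGroup.map (PathSpace.const f) x g) = FundamentalGroup.map f x g := by
    intro g
    induction g using Path.Homotopic.Quotient.ind with | _ γ
    rfl
  have hid : ∀ {y : X} (γ : Path.Homotopic.Quotient x y),
      (γ.map (PathSpace.const f)).map (PathSpace.source f) = γ := by
    intro y γ
    induction γ using Path.Homotopic.Quotient.ind with | _ γ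
    rfl
  have hend : ∀ {y : X} (γ : Path.Homotopic.Quotient x y),
      (γ.map (PathSpace.const f)).map (PathSpace.endpoint f) = γ.map f := by
    intro y γ
    induction γ using Path.Homotopic.Quotient.ind with | _ γ
    rfl
  refine ⟨MonoidHom.comp (N := FundamentalGroup Y (PathSpace.endpoint f (PathSpace.const f x))) τ
    (FundamentalGroup.map (PathSpace.endpoint f) (PathSpace.const f x)), fun _ => rfl,
    fun g => congrArg τ (map_endpoint_eq f x g), fun g => congrArg τ (hmap g).symm,
    fun n c => Subtype.ext (funext fun σ => funext fun γ => ?_),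
    fun n c => Subtype.ext (funext fun σ => funext fun γ => ?_)⟩
  · exact congrArg (c.1 σ) (hid γ)
  · exact congrArg (c.1 (f.comp σ)) (hend γ)

variable {q : ℕ} [PathConnectedSpace X]

/-- Loops in `Y` lift to the mapping path space, and `endpoint` and `f ∘ source` agree on
fundamental groups. -/
theorem IsQConnectedMap.map_surjective (hf : IsQConnectedMap q f x) :
    Function.Surjective (FundamentalGroup.map f x) := by
  intro g
  obtain ⟨γ, hγ⟩ := liftsPaths_of_hasLift (hf.hasLift_endpoint (n := 1) (by omega))
    (PathSpace.const f x) (PathSpace.const f x) (FundamentalGroup.toPath g)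
  exact ⟨FundamentalGroup.map (PathSpace.source f) (PathSpace.const f x) γ,
    (map_endpoint_eq f x γ).symm.trans hγ⟩

theorem IsQConnectedMap.cohomologyMap_injective (hf : IsQConnectedMap q f x)
    (τ : FundamentalGroup Y (f x) →* LinearMap.GeneralLinearGroup k V) {n : ℕ} (hn : n ≤ q + 1) :
    Function.Injective (cohomologyMap f x τ n) := by
  obtain ⟨τP, hp, hr, hj, hjr, hjp⟩ := exists_pathSpace_comparison τ
  rw [injective_iff_map_eq_zero]
  intro a ha
  obtain ⟨⟨c, hc⟩, rfl⟩ := Submodule.mkQ_surjective _ a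
  refine (Submodule.Quotient.mk_eq_zero _).2 ?_
  have ha' : cochainPullback f x τ (τ.comp (FundamentalGroup.map f x)) (fun _ => rfl) n c ∈
      twistedCoboundaries x (τ.comp (FundamentalGroup.map f x)) n :=
    (Submodule.Quotient.mk_eq_zero ((twistedCoboundaries x _ n).submoduleOf
      (LinearMap.ker (twistedDifferential x _ n)))).1 ha
  change c ∈ twistedCoboundaries (f x) τ n
  refine mem_coboundaries_of_cochainPullback (p := PathSpace.endpoint f)
    (e₀ := PathSpace.const f x) (q := q + 1) hp
    (fun m hm => hf.hasLift_endpoint hm) (by omega) hn c ?_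
  have hc₀ := LinearMap.mem_ker.1 hc
  obtain ⟨b, -, hb⟩ := exists_cochainPullback_sub_mem_coboundaries (p := PathSpace.source f)
    (q := n + 1) hr (fun m _ => hasLift_source_cube f m) le_rfl _
    (twistedDifferential_cochainPullback_eq_zero (f := PathSpace.endpoint f)
      (x := PathSpace.const f x) hp hc₀)
  have hb' := cochainPullback_mem_coboundaries hj hb
  rw [map_sub] at hb'
  have hbc : b ∈ twistedCoboundaries x (τ.comp (FundamentalGroup.map f x)) n :=
    (Submodule.sub_mem_iff_left _ ha').1 <|
      (congrArg (· ∈ twistedCoboundaries x (τ.comp (FundamentalGroup.map f x)) n)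
        (congrArg₂ HSub.hSub (hjr n b) (hjp n c))).mp hb'
  exact (Submodule.sub_mem_iff_right _ (cochainPullback_mem_coboundaries
    (f := PathSpace.source f) (x := PathSpace.const f x) hr hbc)).1 hb

theorem IsQConnectedMap.cohomologyMap_surjective (hf : IsQConnectedMap q f x)
    (τ : FundamentalGroup Y (f x) →* LinearMap.GeneralLinearGroup k V) {n : ℕ} (hn : n ≤ q) :
    Function.Surjective (cohomologyMap f x τ n) := by
  obtain ⟨τP, hp, hr, hj, hjr, hjp⟩ := exists_pathSpace_comparison τ
  intro a
  obtain ⟨⟨c, hc⟩, rfl⟩ := Submodule.mkQ_surjective _ a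
  have hc₀ := LinearMap.mem_ker.1 hc
  obtain ⟨b, hb, hbc⟩ := exists_cochainPullback_sub_mem_coboundaries
    (p := PathSpace.endpoint f) (q := q + 1) hp (fun m hm => hf.hasLift_endpoint hm)
    (Nat.succ_le_succ hn) _
    (twistedDifferential_cochainPullback_eq_zero (f := PathSpace.source f)
      (x := PathSpace.const f x) hr hc₀)
  have hb' := cochainPullback_mem_coboundaries hj hbc
  rw [map_sub] at hb'
  exact ⟨Submodule.Quotient.mk ⟨b, hb⟩, (Submodule.Quotient.eq _).2 <|
    (congrArg (· ∈ twistedCoboundaries x _ n)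
      (congrArg₂ HSub.hSub (hjp n b) (hjr n c))).mp hb'⟩

theorem IsQConnectedMap.mapsTo_jumpLocus (hf : IsQConnectedMap q f x) {N : ℕ}
    {G : Subgroup (GL (Fin N) k)} (ι : G →* LinearMap.GeneralLinearGroup k V) {n : ℕ}
    (hn : n ≤ q + 1) (r : ℕ) :
    Set.MapsTo (repPullback (FundamentalGroup.map f x) G) (jumpLocus (f x) ι n r)
      (jumpLocus x ι n r) := by
  intro ρ hρ
  have h := LinearMap.lift_rank_le_of_injective _
    (hf.cohomologyMap_injective (ι.comp ρ) hn)
  exact Cardinal.nat_le_lift_iff.1 ((Cardinal.nat_le_lift_iff.2 hρ).trans h)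

theorem IsQConnectedMap.mem_jumpLocus (hf : IsQConnectedMap q f x) {N : ℕ}
    {G : Subgroup (GL (Fin N) k)} {ι : G →* LinearMap.GeneralLinearGroup k V} {n : ℕ}
    (hn : n ≤ q) {r : ℕ} {ρ : FundamentalGroup Y (f x) →* G}
    (hρ : repPullback (FundamentalGroup.map f x) G ρ ∈ jumpLocus x ι n r) :
    ρ ∈ jumpLocus (f x) ι n r := by
  have h := LinearMap.lift_rank_le_of_surjective _
    (hf.cohomologyMap_surjective (ι.comp ρ) hn)
  exact Cardinal.nat_le_lift_iff.1 ((Cardinal.nat_le_lift_iff.2 hρ).trans h)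

end QConnected

end JumpLoci

end

theorem corollary5 {k : Type*} [Field k] [CharZero k]
    {X X' : Type*} [TopologicalSpace X] [TopologicalSpace X']
    [PathConnectedSpace X] [PathConnectedSpace X']
    (x : X) (f : C(X, X')) (q : ℕ) (hq : 1 ≤ q)
    (hX : JumpLoci.IsQFinite q X) (hX' : JumpLoci.IsQFinite q X')
    (hf : JumpLoci.IsQConnectedMap (q - 1) f x)
    {N : ℕ} (G : Subgroup (GL (Fin N) k)) (hG : JumpLoci.IsLinearAlgebraicGroup G)
    {V : Type*} [AddCommGroup V] [Module k V] [FiniteDimensional k V]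
    (ι : G →* LinearMap.GeneralLinearGroup k V) (hι : JumpLoci.IsRationalRepresentation ι) :
    JumpLoci.IsClosedEmbeddingOfRepVarieties (FundamentalGroup.map f x) G ∧
    (∀ i < q, ∀ r : ℕ,
      ∃ h : Set.MapsTo (JumpLoci.repPullback (FundamentalGroup.map f x) G)
          (JumpLoci.jumpLocus (f x) ι i r)
          (JumpLoci.jumpLocus x ι i r ∩
            Set.range (JumpLoci.repPullback (FundamentalGroup.map f x) G)),
        JumpLoci.IsVarietyIso h.restrict) ∧
    (∀ r : ℕ,
      ∃ h : Set.MapsTo (JumpLoci.repPullback (FundamentalGroup.map f x) G)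
          (JumpLoci.jumpLocus (f x) ι q r) (JumpLoci.jumpLocus x ι q r),
        JumpLoci.IsVarietyEmbedding h.restrict) := by
  have hs := hf.map_surjective
  refine ⟨JumpLoci.isClosedEmbeddingOfRepVarieties hs, fun i hi r => ⟨fun ρ hρ =>
    ⟨hf.mapsTo_jumpLocus ι (by omega) r hρ, Set.mem_range_self ρ⟩,
    JumpLoci.isVarietyIso_restrict_repPullback hs _ ?_⟩, fun r =>
    ⟨hf.mapsTo_jumpLocus ι (by omega) r, JumpLoci.isVarietyEmbedding_restrict_repPullback hs _⟩⟩
  rintro _ ⟨hρ, ρ, rfl⟩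
  exact ⟨ρ, hf.mem_jumpLocus (by omega) hρ, rfl⟩
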